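/- **Theorem 3.1.** Let $n\ge 1$, let $\Omega\subset\mathbb{E}^n$ be a bounded convex domain with diameter $\mathfrak d$, let $P\in\partial\Omega$ be a fixed point and $0<\alpha<1$. For $Q\in\Omega$ put $r=|P-Q|$, $\mathbf e=(Q-P)/r$, $T=P+t\mathbf e$, and define the Kipriyanov fractional derivative of a complex-valued function $f$ on $\Omega$ by $$(\mathfrak D^\alpha f)(Q)=\frac{\alpha}{\Gamma(1-\alpha)}\int_0^r\frac{f(Q)-f(T)}{(r-t)^{\alpha+1}}\Big(\frac tr\Big)^{n-1}dt+C_n^{(\alpha)}f(Q)\,r^{-\alpha},\qquad C_n^{(\alpha)}=\frac{(n-1)!}{\Gamma(n-\alpha)}.$$ Let $\rho$ be a real function, non-negative on $\Omega$, such that $|\rho(Q)-\rho(Q')|\le M|Q-Q'|^\lambda$ for all $Q,Q'\in\overline\Omega$, with constants $M\ge 0$ and $\lambda>\alpha$. Let $L_2(\Omega,\rho)$ be the $L_2$ space of complex-valued functions with respect to the measure $\rho(Q)\,dQ$ on $\Omega$, with inner product $(f,g)_{L_2(\Omega,\rho)}=\int_\Omega f\,\overline g\,\rho\,dQ$. Let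 $H_0^1(\Omega)$ be the closure of $C_0^\infty(\Omega)$ in the Sobolev space $H^1(\Omega)$ (complex-valued). Then for every $f\in H_0^1(\Omega)$ the function $f$ lies in $L_2(\Omega,\rho)$, the integral defining $(\mathfrak D^\alpha f)(Q)$ converges absolutely for almost every $Q\in\Omega$, and $\mathfrak D^\alpha f\in L_2(\Omega,\rho)$. Moreover: 1. If $\inf_\Omega\rho>0$, then $$\operatorname{Re}(f,\mathfrak D^\alpha f)_{L_2(\Omega,\rho)}\ \ge\ \mu\,\|f\|^2_{L_2(\Omega,\rho)},\qquad f\in H_0^1(\Omega),$$ where $$\mu=\frac12\,\mathfrak d^{-\alpha}\Big(\frac1{\Gamma(1-\alpha)}+C_n^{(\alpha)}\Big)-\frac{\alpha M\,\mathfrak d^{\lambda-\alpha}}{2\,\Gamma(1-\alpha)(\lambda-\alpha)\inf_\Omega\rho}.$$ 2. If in addition to the standing assumptions (where $\inf_\Omega\rho=0$ is allowed) $\rho$ is non-increasing in $\Omega$ along every ray issuing from $P$, then the same inequality holds for all $f\in H_0^1(\Omega)$ with $$\mu=\frac12\,\mathfrak d^{-\alpha}\Big(\frac1{\Gamma(1-\alpha)}+C_n^{(\alpha)}\Big).$$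 -/

import Mathlib

open MeasureTheory Set Filter Topology

/-- A complex-valued function of class `C₀^∞(Ω)`: smooth, with compact support contained in `Ω`. -/
def IsTestFunction {n : ℕ} (Ω : Set (EuclideanSpace ℝ (Fin n)))
    (φ : EuclideanSpace ℝ (Fin n) → ℂ) : Prop :=
  ContDiff ℝ (⊤ : ℕ∞) φ ∧ HasCompactSupport φ ∧ tsupport φ ⊆ Ω

/-- The classical partial derivative with respect to the `i`-th coordinate. -/
noncomputable def partialDeriv {n : ℕ} (i : Fin n) (φ : EuclideanSpace ℝ (Fin n) → ℂ) :
    EuclideanSpace ℝ (Fin n) → ℂ :=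
  fun Q => fderiv ℝ φ Q (EuclideanSpace.single i 1)

/-- `g` is the weak derivative of `f` on `Ω` with respect to the `i`-th coordinate
(used below for `f` and `g` in `L₂(Ω)` only). -/
def IsWeakPartialDeriv {n : ℕ} (Ω : Set (EuclideanSpace ℝ (Fin n))) (i : Fin n)
    (f g : EuclideanSpace ℝ (Fin n) → ℂ) : Prop :=
  ∀ φ : EuclideanSpace ℝ (Fin n) → ℂ, IsTestFunction Ω φ →
    ∫ Q in Ω, f Q * partialDeriv i φ Q = - ∫ Q in Ω, g Q * φ Q

/-- `f ∈ H₀¹(Ω)`: `f` lies in `L₂(Ω)`, has weak first derivatives `g i` in `L₂(Ω)`, and is the limit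
in the norm of `H¹(Ω)` of a sequence of functions from `C₀^∞(Ω)`. -/
def MemH10 {n : ℕ} (Ω : Set (EuclideanSpace ℝ (Fin n)))
    (f : EuclideanSpace ℝ (Fin n) → ℂ) : Prop :=
  MemLp f 2 (volume.restrict Ω) ∧
  ∃ g : Fin n → EuclideanSpace ℝ (Fin n) → ℂ,
    (∀ i, MemLp (g i) 2 (volume.restrict Ω) ∧ IsWeakPartialDeriv Ω i f (g i)) ∧
    ∃ φ : ℕ → EuclideanSpace ℝ (Fin n) → ℂ,
      (∀ k, IsTestFunction Ω (φ k)) ∧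
      Tendsto (fun k => eLpNorm (φ k - f) 2 (volume.restrict Ω)) atTop (𝓝 0) ∧
      ∀ i, Tendsto (fun k => eLpNorm (partialDeriv i (φ k) - g i) 2 (volume.restrict Ω))
        atTop (𝓝 0)

/-- The measure `ρ(Q) dQ` on `Ω`, so that `L₂(Ω, ρ)` is the `L₂` space of this measure. -/
noncomputable def weightedMeasure {n : ℕ} (Ω : Set (EuclideanSpace ℝ (Fin n)))
    (ρ : EuclideanSpace ℝ (Fin n) → ℝ) : Measure (EuclideanSpace ℝ (Fin n)) :=
  (volume.restrict Ω).withDensity (fun Q => ENNReal.ofReal (ρ Q))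

/-- The inner product `(f, g) = ∫_Ω f(Q) conj(g(Q)) ρ(Q) dQ` of `L₂(Ω, ρ)`. -/
noncomputable def weightedInner {n : ℕ} (Ω : Set (EuclideanSpace ℝ (Fin n)))
    (ρ : EuclideanSpace ℝ (Fin n) → ℝ) (f g : EuclideanSpace ℝ (Fin n) → ℂ) : ℂ :=
  ∫ Q, f Q * (starRingEnd ℂ) (g Q) ∂(weightedMeasure Ω ρ)

/-- The squared norm `∫_Ω |f(Q)|² ρ(Q) dQ` of `L₂(Ω, ρ)`. -/
noncomputable def weightedNormSq {n : ℕ} (Ω : Set (EuclideanSpace ℝ (Fin n)))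
    (ρ : EuclideanSpace ℝ (Fin n) → ℝ) (f : EuclideanSpace ℝ (Fin n) → ℂ) : ℝ :=
  ∫ Q, ‖f Q‖ ^ 2 ∂(weightedMeasure Ω ρ)

/-- The constant `C_n^{(α)} = (n-1)! / Γ(n-α)`. -/
noncomputable def kipriyanovConst (n : ℕ) (α : ℝ) : ℝ :=
  (Nat.factorial (n - 1) : ℝ) / Real.Gamma ((n : ℝ) - α)

/-- The point `T = P + t e` of the ray from `P` through `Q`, with `e = (Q - P)/|Q - P|`. -/
noncomputable def rayPoint {n : ℕ} (P Q : EuclideanSpace ℝ (Fin n)) (t : ℝ) :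
    EuclideanSpace ℝ (Fin n) :=
  P + t • ((dist P Q)⁻¹ • (Q - P))

/-- The integrand `(f(Q) - f(T)) / (r - t)^{α+1} * (t/r)^{n-1}` of the Kipriyanov derivative,
where `r = |P - Q|`. -/
noncomputable def kipriyanovIntegrand {n : ℕ} (α : ℝ) (P : EuclideanSpace ℝ (Fin n))
    (f : EuclideanSpace ℝ (Fin n) → ℂ) (Q : EuclideanSpace ℝ (Fin n)) (t : ℝ) : ℂ :=
  (f Q - f (rayPoint P Q t)) / (((dist P Q - t) ^ (α + 1) : ℝ) : ℂ) *
    (((t / dist P Q) ^ (n - 1) : ℝ) : ℂ)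

/-- The Kipriyanov fractional derivative of order `α` of `f`, with respect to the point `P`. -/
noncomputable def kipriyanovDeriv {n : ℕ} (α : ℝ) (P : EuclideanSpace ℝ (Fin n))
    (f : EuclideanSpace ℝ (Fin n) → ℂ) (Q : EuclideanSpace ℝ (Fin n)) : ℂ :=
  ((α / Real.Gamma (1 - α) : ℝ) : ℂ) * (∫ t in (0 : ℝ)..(dist P Q), kipriyanovIntegrand α P f Q t) +
    ((kipriyanovConst n α * (dist P Q) ^ (-α) : ℝ) : ℂ) * f Q

/-- In every fixed direction `e` from `P`, the function `ρ` is non-increasing along the part of the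
ray `{P + t e : t > 0}` that lies in `Ω`. -/
def NonincreasingAlongRays {n : ℕ} (Ω : Set (EuclideanSpace ℝ (Fin n)))
    (P : EuclideanSpace ℝ (Fin n)) (ρ : EuclideanSpace ℝ (Fin n) → ℝ) : Prop :=
  ∀ e : EuclideanSpace ℝ (Fin n), ‖e‖ = 1 →
    AntitoneOn (fun t : ℝ => ρ (P + t • e)) {t : ℝ | 0 < t ∧ P + t • e ∈ Ω}

/-! Write r = |P - Q|, let 𝔡 be the diameter, and substitute t = r s. The integral in the Kipriyanov
derivative becomes r^{-α} ∫₀¹ k(s) (f(Q) - f(T)) ds, where k(s) = s^{n-1} (1-s)^{-α-1} and T = P +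
s(Q - P). Everything thus reduces to homotheties about P, and convexity keeps T in Ω.

Mapping into L₂. For a test function, f(Q) - f(T) is an integral of the gradient along the ray.
After exchanging integrals one has an average of |P - ·|^{1-α} |∇f| over homotheties. A homothety of
ratio u multiplies L₂ norms by u^{-n/2}, and the averaging kernel stays integrable against this
factor (`exists_kipriyanovAbs_bound`). The same averaging gives a Hardy inequality for r^{-α} f
(`exists_hardy_bound`). Fatou's lemma carries both bounds to H₀¹.

Lower bound. Start from 2 Re f(Q) conj(f(Q) - f(T)) ≥ |f(Q)|² - |f(T)|², fix s, integrate over Q and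
change variables from Q to T (`slice_energy_ge`). Put A = ∫ ρ r^{-α} |f|². Three effects appear. (a)
The Jacobian turns k(s) into s^{α-1} (1-s)^{-α-1} in the second term. The two singularities at s = 1
cancel, and the difference integrates to Γ(1-α) C/α with C = C_n^{(α)}
(`integral_kernel_difference`). After multiplication by α/(2Γ(1-α)) this costs C A/2, half of what
the zero-order term C r^{-α} f supplies; the other half is at least C 𝔡^{-α}/2 times the squared
norm. (b) Since Q lies in Ω, T only reaches |P - T| ≤ s𝔡. The mass beyond that radius is never
subtracted, and integrating over s gives the term with 1/Γ(1-α) (`radial_head_eq`). (c) Replacing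
ρ(Q) by ρ(T) costs M((1-s) r)^λ, which is integrable against the singularity because λ > α
(`radial_tail_le`). Comparing ∫|f|² with ∫ρ|f|² brings in inf ρ. If ρ is non-increasing along rays,
this cost is zero and the same argument runs with M = 0. -/

/-! ### Homotheties about P and averages over them -/

/-- The point `P + s (Q - P)`: the image of `Q` under the homothety of ratio `s` about `P`. -/
noncomputable def dil {n : ℕ} (P : EuclideanSpace ℝ (Fin n)) (s : ℝ)
    (Q : EuclideanSpace ℝ (Fin n)) : EuclideanSpace ℝ (Fin n) := P + s • (Q - P)

theorem dil_one {n : ℕ} (P Q : EuclideanSpace ℝ (Fin n)) : dil P 1 Q = Q := by simp [dil]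

theorem dil_zero {n : ℕ} (P Q : EuclideanSpace ℝ (Fin n)) : dil P 0 Q = P := by simp [dil]

theorem continuous_dil_prod {n : ℕ} (P : EuclideanSpace ℝ (Fin n)) :
    Continuous (fun z : ℝ × EuclideanSpace ℝ (Fin n) => dil P z.1 z.2) := by
  unfold dil; fun_prop

theorem measurable_dil {n : ℕ} (P : EuclideanSpace ℝ (Fin n)) (s : ℝ) :
    Measurable (dil P s) := by
  unfold dil; fun_prop

@[fun_prop]
theorem Measurable.dil {X : Type*} [MeasurableSpace X] {n : ℕ} {P : EuclideanSpace ℝ (Fin n)}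
    {a : X → ℝ} {f : X → EuclideanSpace ℝ (Fin n)} (ha : Measurable a) (hf : Measurable f) :
    Measurable (fun x => dil P (a x) (f x)) :=
  (continuous_dil_prod P).measurable.comp (ha.prodMk hf)

theorem dist_dil {n : ℕ} (P Q : EuclideanSpace ℝ (Fin n)) {s : ℝ} (hs : 0 ≤ s) :
    dist P (dil P s Q) = s * dist P Q := by
  rw [dist_comm P, dist_comm P, dil, dist_eq_norm, add_sub_cancel_left, norm_smul,
    Real.norm_of_nonneg hs, dist_eq_norm]

theorem hasDerivAt_dil {n : ℕ} (P Q : EuclideanSpace ℝ (Fin n)) (s : ℝ) :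
    HasDerivAt (fun u => dil P u Q) (Q - P) s := by
  unfold dil
  simpa using ((hasDerivAt_id s).smul_const (Q - P)).const_add P

/-- Change of variables under a homothety. -/
theorem lintegral_comp_dil {n : ℕ} (P : EuclideanSpace ℝ (Fin n)) {s : ℝ} (hs : 0 < s)
    {h : EuclideanSpace ℝ (Fin n) → ENNReal} (hh : Measurable h) :
    ∫⁻ Q, h (dil P s Q) = ENNReal.ofReal (s ^ (-(n : ℝ))) * ∫⁻ Q, h Q := by
  unfold dil
  have h1 : ∫⁻ Q, h (P + s • (Q - P)) = ∫⁻ Q, h (P + s • Q) :=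
    lintegral_sub_right_eq_self (μ := volume) (fun Q => h (P + s • Q)) P
  have h2 : ∫⁻ Q, h (P + s • Q) = ∫⁻ Q, h (P + Q)
      ∂(Measure.map (fun x : EuclideanSpace ℝ (Fin n) => s • x) volume) := by
    rw [lintegral_map (by fun_prop) (by fun_prop)]
  rw [h1, h2, Measure.map_addHaar_smul _ hs.ne', lintegral_smul_measure,
    lintegral_add_left_eq_self (μ := volume) h P, smul_eq_mul, finrank_euclideanSpace_fin,
    abs_of_pos (by positivity), Real.rpow_neg hs.le, Real.rpow_natCast]

/-- Cauchy--Schwarz inequality with a weight. -/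
theorem sq_lintegral_mul_le {X : Type*} [MeasurableSpace X] {μ : Measure X}
    {f g : X → ENNReal} (hf : AEMeasurable f μ) (hg : AEMeasurable g μ) :
    (∫⁻ x, f x * g x ∂μ) ^ 2 ≤ (∫⁻ x, f x ^ 2 ∂μ) * ∫⁻ x, g x ^ 2 ∂μ := by
  have h := ENNReal.lintegral_mul_le_Lp_mul_Lq μ Real.HolderConjugate.two_two hf hg
  have h' := pow_le_pow_left₀ zero_le h 2
  refine h'.trans (le_of_eq ?_)
  rw [mul_pow, ← ENNReal.rpow_natCast, ← ENNReal.rpow_natCast, ← ENNReal.rpow_mul,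
    ← ENNReal.rpow_mul]
  simp

theorem sq_lintegral_weight_mul_le {X : Type*} [MeasurableSpace X] {μ : Measure X}
    {w h : X → ENNReal} (hw : Measurable w) (hh : Measurable h) :
    (∫⁻ x, w x * h x ∂μ) ^ 2 ≤ (∫⁻ x, w x ∂μ) * ∫⁻ x, w x * h x ^ 2 ∂μ := by
  have := sq_lintegral_mul_le (μ := μ.withDensity w) (f := fun _ => 1) (g := h)
    measurable_const.aemeasurable hh.aemeasurable
  simpa [lintegral_withDensity_eq_lintegral_mul _ hw hh,
    lintegral_withDensity_eq_lintegral_mul _ hw (hh.pow_const 2)] using this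

/-- The `L₂` bound for averages over dilations. -/
theorem lintegral_sq_dil_average_le {n : ℕ} (P : EuclideanSpace ℝ (Fin n)) {S : Set ℝ}
    (hS : MeasurableSet S) (hS0 : ∀ u ∈ S, 0 < u) {a : ℝ → ENNReal} (ha : Measurable a)
    {h : EuclideanSpace ℝ (Fin n) → ENNReal} (hh : Measurable h) :
    ∫⁻ Q, (∫⁻ u in S, a u * h (dil P u Q)) ^ 2 ≤
      (∫⁻ u in S, a u * ENNReal.ofReal (u ^ (-(n : ℝ) / 2))) ^ 2 * ∫⁻ Q, h Q ^ 2 := by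
  set K := ∫⁻ u in S, a u * ENNReal.ofReal (u ^ (-(n : ℝ) / 2)) with hK
  have hjm : Measurable (fun z : EuclideanSpace ℝ (Fin n) × ℝ => h (dil P z.2 z.1)) :=
    hh.comp ((continuous_dil_prod P).measurable.comp measurable_swap)
  -- The factor u^{n/2} is moved onto h because u^{n/2} h(P + u(Q - P)) has the same L₂ norm in Q as
  -- h; what remains, a(u) u^{-n/2}, serves as the Cauchy–Schwarz weight.
  have key : ∀ Q, (∫⁻ u in S, a u * h (dil P u Q)) ^ 2 ≤
      K * ∫⁻ u in S, a u * ENNReal.ofReal (u ^ (-(n : ℝ) / 2)) *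
        (ENNReal.ofReal (u ^ ((n : ℝ) / 2)) * h (dil P u Q)) ^ 2 := by
    intro Q
    have hm : Measurable (fun u : ℝ => ENNReal.ofReal (u ^ ((n : ℝ) / 2)) * h (dil P u Q)) :=
      (by fun_prop : Measurable fun u : ℝ => ENNReal.ofReal (u ^ ((n : ℝ) / 2))).mul
        (hjm.comp (by fun_prop : Measurable fun u : ℝ => (Q, u)))
    refine le_trans (le_of_eq ?_) (sq_lintegral_weight_mul_le (μ := volume.restrict S)
      (w := fun u => a u * ENNReal.ofReal (u ^ (-(n : ℝ) / 2))) (by fun_prop) hm)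
    congr 1
    refine setLIntegral_congr_fun hS fun u hu => ?_
    have hu := hS0 u hu
    show _ = a u * ENNReal.ofReal (u ^ (-(n : ℝ) / 2)) *
      (ENNReal.ofReal (u ^ ((n : ℝ) / 2)) * h (dil P u Q))
    rw [mul_assoc, ← mul_assoc (ENNReal.ofReal _) (ENNReal.ofReal _),
      ← ENNReal.ofReal_mul (by positivity), ← Real.rpow_add hu]
    simp [neg_div]
  refine (lintegral_mono key).trans ?_
  have hjm2 : Measurable (fun z : EuclideanSpace ℝ (Fin n) × ℝ =>
      a z.2 * ENNReal.ofReal (z.2 ^ (-(n : ℝ) / 2)) *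
        (ENNReal.ofReal (z.2 ^ ((n : ℝ) / 2)) * h (dil P z.2 z.1)) ^ 2) := by
    fun_prop
  rw [lintegral_const_mul _ hjm2.lintegral_prod_right', lintegral_lintegral_swap hjm2.aemeasurable,
    pow_two, mul_assoc]
  gcongr
  rw [hK, ← lintegral_mul_const _ (by fun_prop)]
  refine le_of_eq (setLIntegral_congr_fun hS fun u hu => ?_)
  have hu := hS0 u hu
  have hmu : Measurable (fun Q => h (dil P u Q)) := hh.comp (measurable_dil P u)
  simp only [mul_pow]
  rw [lintegral_const_mul _ (by fun_prop), lintegral_const_mul _ (by fun_prop),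
    lintegral_comp_dil P hu (h := fun Q => h Q ^ 2) (by fun_prop), ← mul_assoc (_ ^ 2),
    ← ENNReal.ofReal_pow (by positivity), ← ENNReal.ofReal_mul (by positivity),
    ← Real.rpow_natCast, ← Real.rpow_mul hu.le, ← Real.rpow_add hu]
  simp

/-! ### One-dimensional integrals of the kernel -/

/-- The density of the Beta distribution has total mass one; this encodes both the integrability
here and the value in `integral_beta`. -/
theorem integrableOn_beta {a b : ℝ} (ha : 0 < a) (hb : 0 < b) :
    IntegrableOn (fun x : ℝ => x ^ (a - 1) * (1 - x) ^ (b - 1)) (Ioo 0 1) := by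
  have h := ProbabilityTheory.lintegral_betaPDF_eq_one ha hb
  rw [ProbabilityTheory.lintegral_betaPDF] at h
  have hB := ProbabilityTheory.beta_pos ha hb
  have h1 : IntegrableOn (fun x : ℝ =>
      1 / ProbabilityTheory.beta a b * x ^ (a - 1) * (1 - x) ^ (b - 1)) (Ioo 0 1) := by
    refine (lintegral_ofReal_ne_top_iff_integrable (by fun_prop) ?_).1 (by rw [h]; simp)
    refine (ae_restrict_iff' measurableSet_Ioo).2 (ae_of_all _ fun x hx => ?_)
    have h1 := hx.1
    have h2 : 0 < 1 - x := by linarith [hx.2]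
    simp only [Pi.zero_apply]
    positivity
  refine (h1.const_mul (ProbabilityTheory.beta a b)).congr (ae_of_all _ fun x => ?_)
  simp only
  field_simp

theorem integral_beta {a b : ℝ} (ha : 0 < a) (hb : 0 < b) :
    ∫ x in Ioo (0 : ℝ) 1, x ^ (a - 1) * (1 - x) ^ (b - 1) =
      Real.Gamma a * Real.Gamma b / Real.Gamma (a + b) := by
  have h := ProbabilityTheory.lintegral_betaPDF_eq_one ha hb
  rw [ProbabilityTheory.lintegral_betaPDF] at h
  have hB := ProbabilityTheory.beta_pos ha hb
  have h1 : ∫ x in Ioo (0 : ℝ) 1,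
      1 / ProbabilityTheory.beta a b * x ^ (a - 1) * (1 - x) ^ (b - 1) = 1 := by
    rw [integral_eq_lintegral_of_nonneg_ae _ (by fun_prop), h, ENNReal.toReal_one]
    refine (ae_restrict_iff' measurableSet_Ioo).2 (ae_of_all _ fun x hx => ?_)
    have h1 := hx.1
    have h2 : 0 < 1 - x := by linarith [hx.2]
    simp only [Pi.zero_apply]
    positivity
  simp only [mul_assoc, integral_const_mul] at h1
  change _ = ProbabilityTheory.beta a b
  field_simp at h1
  exact h1

/-- The kernel `s^{n-1} (1-s)^{-α-1}`. -/
noncomputable def kipriyanovKernel (n : ℕ) (α s : ℝ) : ℝ := s ^ (n - 1) * (1 - s) ^ (-α - 1)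

@[fun_prop]
theorem measurable_kipriyanovKernel (n : ℕ) (α : ℝ) : Measurable (kipriyanovKernel n α) := by
  unfold kipriyanovKernel; fun_prop

theorem kipriyanovKernel_pos {n : ℕ} {α s : ℝ} (hs : s ∈ Ioo (0 : ℝ) 1) :
    0 < kipriyanovKernel n α s := by
  have h1 := hs.1
  have h2 : 0 < 1 - s := by linarith [hs.2]
  unfold kipriyanovKernel; positivity

theorem integral_one_sub_rpow {α u : ℝ} (hα : 0 < α) (hu : u ∈ Ioo (0 : ℝ) 1) :
    IntegrableOn (fun s : ℝ => (1 - s) ^ (-α - 1)) (Ioc 0 u) ∧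
    ∫ s in Ioc 0 u, (1 - s) ^ (-α - 1) = ((1 - u) ^ (-α) - 1) / α := by
  have hd : ∀ s ∈ Icc 0 u,
      HasDerivAt (fun s : ℝ => (1 - s) ^ (-α) / α) ((1 - s) ^ (-α - 1)) s := by
    intro s hs
    have h2 : 1 - s ≠ 0 := by linarith [hs.2, hu.2]
    have := (((hasDerivAt_id s).const_sub 1).rpow_const (p := -α) (Or.inl h2)).div_const α
    refine HasDerivAt.congr_deriv this ?_
    simp only [id]
    field_simp
  have hi : IntegrableOn (fun s : ℝ => (1 - s) ^ (-α - 1)) (Ioc 0 u) := by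
    refine intervalIntegral.integrableOn_deriv_of_nonneg
      (fun s hs => (hd s hs).continuousAt.continuousWithinAt)
      (fun s hs => hd s (Ioo_subset_Icc_self hs)) fun s hs => ?_
    have : 0 < 1 - s := by linarith [hs.2, hu.2]
    positivity
  refine ⟨hi, ?_⟩
  rw [← intervalIntegral.integral_of_le hu.1.le, intervalIntegral.integral_eq_sub_of_hasDerivAt
    (fun s hs => hd s (by rwa [uIcc_of_le hu.1.le] at hs))
    ((intervalIntegrable_iff_integrableOn_Ioc_of_le hu.1.le).2 hi)]
  simp
  ring

/-- The primitive of the kernel is bounded by `u^n (1-u)^{-α} / α`. -/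
theorem lintegral_kipriyanovKernel_le {n : ℕ} (hn : 1 ≤ n) {α u : ℝ} (hα : 0 < α) (hα1 : α < 1)
    (hu : u ∈ Ioo (0 : ℝ) 1) :
    ∫⁻ s in Ioo 0 u, ENNReal.ofReal (kipriyanovKernel n α s) ≤
      ENNReal.ofReal (u ^ n * (1 - u) ^ (-α) / α) := by
  obtain ⟨hi, hv⟩ := integral_one_sub_rpow hα hu
  have h1u : 0 < 1 - u := by linarith [hu.2]
  have hu0 := hu.1
  calc ∫⁻ s in Ioo 0 u, ENNReal.ofReal (kipriyanovKernel n α s)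
      ≤ ∫⁻ s in Ioo 0 u, ENNReal.ofReal (u ^ (n - 1) * (1 - s) ^ (-α - 1)) := by
        refine setLIntegral_mono' measurableSet_Ioo fun s hs => ENNReal.ofReal_le_ofReal ?_
        have : 0 < 1 - s := by linarith [hs.2, hu.2]
        have := hs.1.le
        have := hs.2.le
        unfold kipriyanovKernel
        gcongr
    _ ≤ ∫⁻ s in Ioc 0 u, ENNReal.ofReal (u ^ (n - 1) * (1 - s) ^ (-α - 1)) :=
        lintegral_mono_set Ioo_subset_Ioc_self
    _ = ENNReal.ofReal (∫ s in Ioc 0 u, u ^ (n - 1) * (1 - s) ^ (-α - 1)) := by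
        rw [ofReal_integral_eq_lintegral_ofReal (hi.const_mul _)]
        refine (ae_restrict_iff' measurableSet_Ioc).2 (ae_of_all _ fun s hs => ?_)
        have : 0 < 1 - s := by linarith [hs.2, hu.2]
        simp only [Pi.zero_apply]
        positivity
    _ ≤ _ := by
        refine ENNReal.ofReal_le_ofReal ?_
        rw [integral_const_mul, hv, ← mul_div_assoc]
        -- The extra factor u, obtained from 1 - u ≤ (1 - u)^α, is needed near u = 0: for n = 1 and
        -- α ≤ 1/2 the later average over homotheties would diverge without it.
        have h2 : (1 - u) ^ (-α) - 1 ≤ u * (1 - u) ^ (-α) := by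
          have : 1 - u ≤ (1 - u) ^ α := by
            simpa using Real.rpow_le_rpow_of_exponent_ge h1u (by linarith) hα1.le
          have h3 : (1 - u) * (1 - u) ^ (-α) ≤ (1 - u) ^ α * (1 - u) ^ (-α) := by gcongr
          rw [← Real.rpow_add h1u] at h3
          simp at h3
          linarith
        obtain ⟨m, rfl⟩ : ∃ m, n = m + 1 := ⟨n - 1, by omega⟩
        simp only [Nat.add_sub_cancel]
        rw [pow_succ, mul_assoc (u ^ m)]
        gcongr

/-- The antiderivative is -((1-s)/s)^β/β. With β = λ - α and τ = |P - T|/R, this is the total over s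
of the error caused at a fixed T by the growth of the weight. -/
theorem integral_tail_kernel {β τ : ℝ} (hβ : 0 < β) (hτ : 0 < τ) (hτ1 : τ ≤ 1) :
    IntegrableOn (fun s : ℝ => (1 - s) ^ (β - 1) * s ^ (-1 - β)) (Ioc τ 1) ∧
    ∫ s in Ioc τ 1, (1 - s) ^ (β - 1) * s ^ (-1 - β) = ((1 - τ) / τ) ^ β / β := by
  have hc : ContinuousOn (fun s : ℝ => -(((1 - s) / s) ^ β / β)) (Icc τ 1) := by
    refine ((ContinuousOn.rpow_const ?_ fun _ _ => Or.inr hβ.le).div_const _).neg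
    refine ContinuousOn.div (by fun_prop) (by fun_prop) fun s hs => ?_
    linarith [hs.1]
  have hd : ∀ s ∈ Ioo τ 1, HasDerivAt (fun s : ℝ => -(((1 - s) / s) ^ β / β))
      ((1 - s) ^ (β - 1) * s ^ (-1 - β)) s := by
    intro s hs
    have h1 : 0 < s := by linarith [hs.1]
    have h2 : 0 < 1 - s := by linarith [hs.2]
    have h3 := ((((((hasDerivAt_id s).const_sub 1).div (hasDerivAt_id s) h1.ne').rpow_const
      (p := β) (Or.inl (div_pos h2 h1).ne')).div_const β).neg)
    refine HasDerivAt.congr_deriv h3 ?_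
    simp only [id, Pi.div_apply]
    have h4 : s ^ (-1 - β) = (s ^ (β - 1))⁻¹ * (s ^ 2)⁻¹ := by
      rw [← Real.rpow_neg h1.le, ← Real.rpow_natCast s 2, ← Real.rpow_neg h1.le,
        ← Real.rpow_add h1]
      congr 1
      push_cast
      ring
    rw [Real.div_rpow h2.le h1.le, h4]
    field_simp
    ring
  have hi : IntegrableOn (fun s : ℝ => (1 - s) ^ (β - 1) * s ^ (-1 - β)) (Ioc τ 1) := by
    refine intervalIntegral.integrableOn_deriv_of_nonneg hc hd fun s hs => ?_
    have h1 : 0 < s := by linarith [hs.1]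
    have h2 : 0 < 1 - s := by linarith [hs.2]
    positivity
  refine ⟨hi, ?_⟩
  rw [← intervalIntegral.integral_of_le hτ1,
    intervalIntegral.integral_eq_sub_of_hasDerivAt_of_le hτ1 hc hd
    ((intervalIntegrable_iff_integrableOn_Ioc_of_le hτ1).2 hi)]
  simp [Real.zero_rpow hβ.ne']

theorem integral_rpow_sub_one {α τ : ℝ} (hα : 0 < α) (hτ : 0 ≤ τ) :
    ∫ s in Ioc 0 τ, s ^ (α - 1) = τ ^ α / α := by
  rw [← intervalIntegral.integral_of_le hτ, integral_rpow (Or.inl (by linarith))]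
  simp [Real.zero_rpow hα.ne']

theorem integral_kernel_difference_one {α : ℝ} (hα : 0 < α) (hα1 : α < 1) :
    IntegrableOn (fun s : ℝ => (s ^ (α - 1) - 1) * (1 - s) ^ (-α - 1)) (Ioo 0 1) ∧
    ∫ s in Ioo (0 : ℝ) 1, (s ^ (α - 1) - 1) * (1 - s) ^ (-α - 1) = 1 / α := by
  -- Explicit antiderivative. The factor s^α - 1 compensates (1-s)^{-α}, so G is continuous up to s
  -- = 1 with value 0 there, and G(0) = -1/α.
  set G : ℝ → ℝ := fun s => (s ^ α - 1) * (1 - s) ^ (-α) / α with hG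
  have hc : ContinuousOn G (Icc 0 1) := by
    intro s hs
    rcases hs.2.lt_or_eq with h | rfl
    · have : 1 - s ≠ 0 := by linarith
      refine ContinuousAt.continuousWithinAt ?_
      have h1 : ContinuousAt (fun s : ℝ => s ^ α) s :=
        Real.continuousAt_rpow_const _ _ (Or.inr hα.le)
      have h2 : ContinuousAt (fun s : ℝ => (1 - s) ^ (-α)) s :=
        ContinuousAt.rpow_const (by fun_prop) (Or.inl this)
      exact ((h1.sub continuousAt_const).mul h2).div_const α
    · have hb : ∀ s ∈ Icc (0 : ℝ) 1, ‖G s‖ ≤ (1 - s) ^ (1 - α) / α := by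
        intro s hs
        rcases hs.2.lt_or_eq with h | rfl
        · have h1 : 0 < 1 - s := by linarith
          have h2 : s ^ α ≤ 1 := Real.rpow_le_one hs.1 hs.2 hα.le
          have h3 : s ≤ s ^ α := by
            simpa using Real.rpow_le_rpow_of_exponent_ge' hs.1 hs.2 hα.le hα1.le
          rw [hG]
          simp only
          rw [norm_div, norm_mul, Real.norm_of_nonneg hα.le, Real.norm_of_nonpos (by linarith),
            Real.norm_of_nonneg (by positivity), sub_eq_add_neg 1 α, Real.rpow_add h1,
            Real.rpow_one]
          gcongr
          linarith
        · simp only [hG]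
          simp
          positivity
      have hG1 : G 1 = 0 := by simp [hG]
      unfold ContinuousWithinAt
      rw [hG1]
      refine squeeze_zero_norm' (a := fun s => (1 - s) ^ (1 - α) / α) ?_ ?_
      · filter_upwards [self_mem_nhdsWithin] with s hs using hb s hs
      · have : Continuous (fun s : ℝ => (1 - s) ^ (1 - α) / α) :=
          (Continuous.rpow_const (by fun_prop) fun _ => Or.inr (by linarith)).div_const _
        have h0 := this.tendsto 1
        simp only [sub_self, Real.zero_rpow (by linarith : 1 - α ≠ 0), zero_div] at h0
        exact h0.mono_left nhdsWithin_le_nhds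
  have hd : ∀ s ∈ Ioo (0 : ℝ) 1,
      HasDerivAt G ((s ^ (α - 1) - 1) * (1 - s) ^ (-α - 1)) s := by
    intro s hs
    have h1 := hs.1
    have h2 : 0 < 1 - s := by linarith [hs.2]
    have h3 := ((((hasDerivAt_id s).rpow_const (p := α) (Or.inl h1.ne')).sub_const 1).mul
      (((hasDerivAt_id s).const_sub 1).rpow_const (p := -α) (Or.inl h2.ne'))).div_const α
    refine HasDerivAt.congr_deriv h3 ?_
    simp only [id]
    rw [Real.rpow_sub h1, Real.rpow_sub h2, Real.rpow_one, Real.rpow_one]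
    field_simp
    ring
  have hi : IntegrableOn (fun s : ℝ => (s ^ (α - 1) - 1) * (1 - s) ^ (-α - 1)) (Ioc 0 1) := by
    refine intervalIntegral.integrableOn_deriv_of_nonneg hc hd fun s hs => ?_
    have h1 := hs.1
    have h2 : 0 < 1 - s := by linarith [hs.2]
    have : 1 ≤ s ^ (α - 1) :=
      Real.one_le_rpow_of_pos_of_le_one_of_nonpos h1 hs.2.le (by linarith)
    have : 0 ≤ s ^ (α - 1) - 1 := by linarith
    positivity
  refine ⟨hi.mono_set Ioo_subset_Ioc_self, ?_⟩
  rw [← integral_Ioc_eq_integral_Ioo, ← intervalIntegral.integral_of_le zero_le_one,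
    intervalIntegral.integral_eq_sub_of_hasDerivAt_of_le zero_le_one hc hd
    ((intervalIntegrable_iff_integrableOn_Ioc_of_le zero_le_one).2 hi)]
  simp [hG, Real.zero_rpow hα.ne']
  ring

/-- The regularised integral of the kernel, which produces the constant `C_n^{(α)}`. -/
theorem integral_kernel_difference {n : ℕ} (hn : 1 ≤ n) {α : ℝ} (hα : 0 < α) (hα1 : α < 1) :
    IntegrableOn (fun s : ℝ => s ^ (α - 1) * (1 - s) ^ (-α - 1) - kipriyanovKernel n α s)
      (Ioo 0 1) ∧
    ∫ s in Ioo (0 : ℝ) 1, (s ^ (α - 1) * (1 - s) ^ (-α - 1) - kipriyanovKernel n α s) =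
      Real.Gamma (1 - α) * kipriyanovConst n α / α := by
  induction n, hn using Nat.le_induction with
  | base =>
    obtain ⟨h1, h2⟩ := integral_kernel_difference_one hα hα1
    have he : (fun s : ℝ => s ^ (α - 1) * (1 - s) ^ (-α - 1) - kipriyanovKernel 1 α s) =
        fun s => (s ^ (α - 1) - 1) * (1 - s) ^ (-α - 1) := by
      ext s; simp [kipriyanovKernel]; ring
    rw [he]
    refine ⟨h1, h2.trans ?_⟩
    have : Real.Gamma (1 - α) ≠ 0 := (Real.Gamma_pos_of_pos (by linarith)).ne'
    simp [kipriyanovConst]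
    field_simp
  | succ n hn ih =>
    obtain ⟨h1, h2⟩ := ih
    have hn0 : (0 : ℝ) < n := by exact_mod_cast hn
    have hb := integrableOn_beta hn0 (by linarith : 0 < 1 - α)
    have hbv := integral_beta hn0 (by linarith : 0 < 1 - α)
    -- Raising n by one adds s^{n-1} (1-s)^{-α-1} (1 - s) = s^{n-1} (1-s)^{-α}, a convergent Beta
    -- integral. The recursion for Γ then identifies the sum with the next constant.
    have he : EqOn (fun s : ℝ => s ^ (α - 1) * (1 - s) ^ (-α - 1) - kipriyanovKernel (n + 1) α s)
        (fun s => (s ^ (α - 1) * (1 - s) ^ (-α - 1) - kipriyanovKernel n α s) +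
          s ^ ((n : ℝ) - 1) * (1 - s) ^ (1 - α - 1)) (Ioo 0 1) := by
      intro s hs
      have h0 := hs.1
      have h3 : 0 < 1 - s := by linarith [hs.2]
      obtain ⟨m, rfl⟩ : ∃ m, n = m + 1 := ⟨n - 1, by omega⟩
      simp only [kipriyanovKernel, Nat.add_sub_cancel]
      rw [show 1 - α - 1 = (-α - 1) + 1 by ring, Real.rpow_add h3, Real.rpow_one,
        show ((m + 1 : ℕ) : ℝ) - 1 = (m : ℝ) by push_cast; ring, Real.rpow_natCast, pow_succ]
      ring
    refine ⟨(h1.add hb).congr_fun he.symm measurableSet_Ioo, ?_⟩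
    rw [setIntegral_congr_fun measurableSet_Ioo he, integral_add h1 hb, h2, hbv]
    have hn1 : (1 : ℝ) ≤ n := by exact_mod_cast hn
    have hna : (0 : ℝ) < n - α := by linarith
    have hg : Real.Gamma ((n : ℝ) - α + 1) = ((n : ℝ) - α) * Real.Gamma ((n : ℝ) - α) :=
      Real.Gamma_add_one hna.ne'
    have hgp := Real.Gamma_pos_of_pos hna
    obtain ⟨m, rfl⟩ : ∃ m, n = m + 1 := ⟨n - 1, by omega⟩
    have hf : Real.Gamma ((m + 1 : ℕ) : ℝ) = (Nat.factorial m : ℝ) := by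
      push_cast; exact Real.Gamma_nat_eq_factorial m
    rw [show ((m + 1 : ℕ) : ℝ) + (1 - α) = ((m + 1 : ℕ) : ℝ) - α + 1 by ring, hf]
    unfold kipriyanovConst
    rw [show ((m + 1 + 1 : ℕ) : ℝ) - α = ((m + 1 : ℕ) : ℝ) - α + 1 by push_cast; ring, hg]
    simp only [Nat.add_sub_cancel, Nat.factorial_succ m]
    push_cast at *
    field_simp
    ring

/-! ### Bounds for test functions: the fractional integral and Hardy's inequality -/

/-- Tonelli on the triangle 0 < s < u < 1. -/
theorem lintegral_triangle_swap {K G : ℝ → ENNReal} (hK : Measurable K) (hG : Measurable G) :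
    ∫⁻ s in Ioo 0 1, K s * ∫⁻ u in Ioo s 1, G u =
      ∫⁻ u in Ioo 0 1, G u * ∫⁻ s in Ioo 0 u, K s := by
  have hm : MeasurableSet {z : ℝ × ℝ | z.1 < z.2} := measurableSet_lt measurable_fst measurable_snd
  have h1 : ∀ s ∈ Ioo (0 : ℝ) 1, K s * ∫⁻ u in Ioo s 1, G u =
      ∫⁻ u in Ioo 0 1, {z : ℝ × ℝ | z.1 < z.2}.indicator (fun z => K z.1 * G z.2) (s, u) := by
    intro s hs
    rw [← lintegral_const_mul _ hG, ← lintegral_indicator measurableSet_Ioo,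
      ← lintegral_indicator measurableSet_Ioo]
    refine lintegral_congr fun u => ?_
    simp only [indicator, mem_Ioo, mem_ofPred_eq]
    have := hs.1
    have := hs.2
    split_ifs <;> grind
  have h2 : ∀ u ∈ Ioo (0 : ℝ) 1, G u * ∫⁻ s in Ioo 0 u, K s =
      ∫⁻ s in Ioo 0 1, {z : ℝ × ℝ | z.1 < z.2}.indicator (fun z => K z.1 * G z.2) (s, u) := by
    intro u hu
    rw [← lintegral_const_mul _ hK, ← lintegral_indicator measurableSet_Ioo,
      ← lintegral_indicator measurableSet_Ioo]
    refine lintegral_congr fun s => ?_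
    simp only [indicator, mem_Ioo, mem_ofPred_eq]
    have := hu.1
    have := hu.2
    split_ifs <;> grind
  rw [setLIntegral_congr_fun measurableSet_Ioo h1, setLIntegral_congr_fun measurableSet_Ioo h2,
    lintegral_lintegral_swap]
  exact (Measurable.indicator (by fun_prop) hm).aemeasurable

/-- Fundamental theorem of calculus along the ray; the curve u ↦ P + u(Q - P) has constant speed |P
- Q|. -/
theorem enorm_sub_le_lintegral_fderiv {n : ℕ} {φ : EuclideanSpace ℝ (Fin n) → ℂ}
    (hφ : ContDiff ℝ 1 φ) (P Q : EuclideanSpace ℝ (Fin n)) {a b : ℝ} (hab : a ≤ b) :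
    ‖φ (dil P b Q) - φ (dil P a Q)‖ₑ ≤
      ENNReal.ofReal (dist P Q) * ∫⁻ u in Ioo a b, ‖fderiv ℝ φ (dil P u Q)‖ₑ := by
  have hc : Continuous (fun u : ℝ => dil P u Q) := by unfold dil; fun_prop
  have hc2 : Continuous (fun u : ℝ => fderiv ℝ φ (dil P u Q)) :=
    (hφ.continuous_fderiv one_ne_zero).comp hc
  have hd : ∀ u ∈ uIcc a b, HasDerivAt (fun u => φ (dil P u Q))
      (fderiv ℝ φ (dil P u Q) (Q - P)) u := fun u _ =>
    ((hφ.differentiable one_ne_zero).differentiableAt.hasFDerivAt).comp_hasDerivAt u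
      (hasDerivAt_dil P Q u)
  rw [← intervalIntegral.integral_eq_sub_of_hasDerivAt hd
    ((hc2.clm_apply continuous_const).intervalIntegrable _ _),
    intervalIntegral.integral_of_le hab, integral_Ioc_eq_integral_Ioo]
  refine (enorm_integral_le_lintegral_enorm _).trans ?_
  rw [← lintegral_const_mul _ (hc2.measurable.enorm)]
  refine lintegral_mono fun u => ?_
  rw [mul_comm, dist_comm, dist_eq_norm, ofReal_norm]
  exact ContinuousLinearMap.le_opENorm _ _

/-- The weighted size of the gradient. -/
noncomputable def weightedGradient {n : ℕ} (α : ℝ) (P : EuclideanSpace ℝ (Fin n))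
    (φ : EuclideanSpace ℝ (Fin n) → ℂ) (Q : EuclideanSpace ℝ (Fin n)) : ENNReal :=
  ENNReal.ofReal (dist P Q ^ (1 - α)) * ‖fderiv ℝ φ Q‖ₑ

theorem measurable_weightedGradient {n : ℕ} (α : ℝ) (P : EuclideanSpace ℝ (Fin n))
    (φ : EuclideanSpace ℝ (Fin n) → ℂ) : Measurable (weightedGradient α P φ) := by
  unfold weightedGradient
  exact (by fun_prop : Measurable fun Q => ENNReal.ofReal (dist P Q ^ (1 - α))).mul
    (measurable_fderiv ℝ φ).enorm

theorem lintegral_weightedGradient_sq_le {n : ℕ} {Ω : Set (EuclideanSpace ℝ (Fin n))}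
    {P : EuclideanSpace ℝ (Fin n)} {R α : ℝ} (hR : ∀ Q ∈ Ω, dist P Q ≤ R) (hα1 : α < 1)
    {φ : EuclideanSpace ℝ (Fin n) → ℂ} (hφ : IsTestFunction Ω φ) :
    ∫⁻ Q, weightedGradient α P φ Q ^ 2 ≤
      ENNReal.ofReal (R ^ (1 - α)) ^ 2 * ∫⁻ Q, ‖fderiv ℝ φ Q‖ₑ ^ 2 := by
  rw [← lintegral_const_mul _ ((measurable_fderiv ℝ φ).enorm.pow_const 2)]
  refine lintegral_mono fun Q => ?_
  simp only [weightedGradient, mul_pow]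
  by_cases hQ : Q ∈ Ω
  · have := hR Q hQ
    gcongr
  · have h0 : fderiv ℝ φ Q = 0 := by
      by_contra h
      exact hQ (hφ.2.2 (support_fderiv_subset ℝ h))
    have : ‖fderiv ℝ φ Q‖ₑ = 0 := by
      rw [← ofReal_norm, h0, norm_zero, ENNReal.ofReal_zero]
    simp [this]

/-- The weight is moved from Q to its image, whose distance to P is u |P - Q|; the price is u^{α-1}.
-/
theorem dist_rpow_mul_fderiv_dil {n : ℕ} {α u : ℝ} (P : EuclideanSpace ℝ (Fin n))
    (φ : EuclideanSpace ℝ (Fin n) → ℂ) (Q : EuclideanSpace ℝ (Fin n)) (hu : 0 < u) :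
    ENNReal.ofReal (dist P Q ^ (1 - α)) * ‖fderiv ℝ φ (dil P u Q)‖ₑ =
      ENNReal.ofReal (u ^ (α - 1)) * weightedGradient α P φ (dil P u Q) := by
  unfold weightedGradient
  rw [dist_dil P Q hu.le, ← mul_assoc, ← ENNReal.ofReal_mul (by positivity),
    Real.mul_rpow hu.le dist_nonneg, ← mul_assoc, ← Real.rpow_add hu]
  simp

theorem ofReal_rpow_neg_mul_le {α r : ℝ} (hr : 0 ≤ r) :
    ENNReal.ofReal (r ^ (-α)) * ENNReal.ofReal r ≤ ENNReal.ofReal (r ^ (1 - α)) := by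
  rcases hr.eq_or_lt with rfl | h
  · simp
  · rw [← ENNReal.ofReal_mul (by positivity), sub_eq_neg_add, Real.rpow_add h, Real.rpow_one]

/-- The absolute version of the integral in the Kipriyanov derivative. -/
noncomputable def kipriyanovAbs {n : ℕ} (α : ℝ) (P : EuclideanSpace ℝ (Fin n))
    (f : EuclideanSpace ℝ (Fin n) → ℂ) (Q : EuclideanSpace ℝ (Fin n)) : ENNReal :=
  ENNReal.ofReal (dist P Q ^ (-α)) *
    ∫⁻ s in Ioo 0 1, ENNReal.ofReal (kipriyanovKernel n α s) * ‖f Q - f (dil P s Q)‖ₑ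

/-- The non-integrable singularity of the kernel at s = 1 is met by the short range (s, 1) of the
gradient integral. After the exchange only the primitive of the kernel enters, of order (1-u)^{-α}.
-/
theorem kipriyanovAbs_le {n : ℕ} (hn : 1 ≤ n) {α : ℝ} (hα : 0 < α) (hα1 : α < 1)
    (P : EuclideanSpace ℝ (Fin n)) {φ : EuclideanSpace ℝ (Fin n) → ℂ} (hφ : ContDiff ℝ 1 φ)
    (Q : EuclideanSpace ℝ (Fin n)) :
    kipriyanovAbs α P φ Q ≤ ∫⁻ u in Ioo 0 1,
      ENNReal.ofReal (u ^ n * (1 - u) ^ (-α) / α * u ^ (α - 1)) *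
        weightedGradient α P φ (dil P u Q) := by
  have hgm : Measurable (fun u : ℝ => ‖fderiv ℝ φ (dil P u Q)‖ₑ) :=
    ((measurable_fderiv ℝ φ).comp (by fun_prop : Measurable fun u : ℝ => dil P u Q)).enorm
  calc kipriyanovAbs α P φ Q
      ≤ ENNReal.ofReal (dist P Q ^ (-α)) * ∫⁻ s in Ioo 0 1,
          ENNReal.ofReal (dist P Q) * (ENNReal.ofReal (kipriyanovKernel n α s) *
            ∫⁻ u in Ioo s 1, ‖fderiv ℝ φ (dil P u Q)‖ₑ) := by
        unfold kipriyanovAbs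
        refine mul_le_mul_right (setLIntegral_mono' measurableSet_Ioo fun s hs => ?_) _
        have := enorm_sub_le_lintegral_fderiv hφ P Q hs.2.le
        rw [dil_one] at this
        rw [mul_left_comm]
        gcongr
    _ ≤ ENNReal.ofReal (dist P Q ^ (1 - α)) * ∫⁻ s in Ioo 0 1,
          (ENNReal.ofReal (kipriyanovKernel n α s) *
            ∫⁻ u in Ioo s 1, ‖fderiv ℝ φ (dil P u Q)‖ₑ) := by
        rw [lintegral_const_mul' _ _ ENNReal.ofReal_ne_top, ← mul_assoc]
        gcongr
        exact ofReal_rpow_neg_mul_le dist_nonneg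
    _ = ∫⁻ u in Ioo 0 1, ENNReal.ofReal (dist P Q ^ (1 - α)) * (‖fderiv ℝ φ (dil P u Q)‖ₑ *
          ∫⁻ s in Ioo 0 u, ENNReal.ofReal (kipriyanovKernel n α s)) := by
        rw [lintegral_triangle_swap (by fun_prop) hgm,
          lintegral_const_mul' _ _ ENNReal.ofReal_ne_top]
    _ ≤ _ := by
        refine setLIntegral_mono' measurableSet_Ioo fun u hu => ?_
        have h1 := hu.1
        have h2 : 0 < 1 - u := by linarith [hu.2]
        rw [← mul_assoc, dist_rpow_mul_fderiv_dil P φ Q hu.1, mul_comm, ← mul_assoc,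
          ENNReal.ofReal_mul (by positivity)]
        gcongr
        exact lintegral_kipriyanovKernel_le hn hα hα1 hu

theorem lintegral_ofReal_beta_lt_top {a b : ℝ} (ha : 0 < a) (hb : 0 < b) :
    ∫⁻ x in Ioo (0 : ℝ) 1, ENNReal.ofReal (x ^ (a - 1) * (1 - x) ^ (b - 1)) < ⊤ := by
  have := (integrableOn_beta ha hb).lintegral_lt_top
  exact this

/-- The integral part of the Kipriyanov derivative is bounded from `H₀¹` to `L₂`. -/
theorem exists_kipriyanovAbs_bound {n : ℕ} (hn : 1 ≤ n) {Ω : Set (EuclideanSpace ℝ (Fin n))}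
    {P : EuclideanSpace ℝ (Fin n)} {R α : ℝ} (hR : ∀ Q ∈ Ω, dist P Q ≤ R) (hα : 0 < α)
    (hα1 : α < 1) :
    ∃ K : ENNReal, K ≠ ⊤ ∧ ∀ φ, IsTestFunction Ω φ →
      ∫⁻ Q, kipriyanovAbs α P φ Q ^ 2 ≤ K * ∫⁻ Q, ‖fderiv ℝ φ Q‖ₑ ^ 2 := by
  set a : ℝ → ENNReal := fun u => ENNReal.ofReal (u ^ n * (1 - u) ^ (-α) / α * u ^ (α - 1))
  have hn0 : (1 : ℝ) ≤ n := by exact_mod_cast hn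
  -- The powers of u add up to n + (α-1) - n/2 = n/2 + α - 1, so up to the factor 1/α this is the
  -- Beta integral B(n/2 + α, 1 - α).
  have hfin : ∫⁻ u in Ioo (0 : ℝ) 1, a u * ENNReal.ofReal (u ^ (-(n : ℝ) / 2)) ≠ ⊤ := by
    have h1 := lintegral_ofReal_beta_lt_top (a := (n : ℝ) / 2 + α) (b := 1 - α)
      (by positivity) (by linarith)
    have h2 : ∫⁻ u in Ioo (0 : ℝ) 1, a u * ENNReal.ofReal (u ^ (-(n : ℝ) / 2)) =
        ENNReal.ofReal α⁻¹ * ∫⁻ x in Ioo (0 : ℝ) 1,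
          ENNReal.ofReal (x ^ ((n : ℝ) / 2 + α - 1) * (1 - x) ^ (1 - α - 1)) := by
      rw [← lintegral_const_mul' _ _ ENNReal.ofReal_ne_top]
      refine setLIntegral_congr_fun measurableSet_Ioo fun u hu => ?_
      have h1 := hu.1
      have h2 : 0 < 1 - u := by linarith [hu.2]
      simp only [a]
      rw [← ENNReal.ofReal_mul (by positivity), ← ENNReal.ofReal_mul (by positivity),
        show (n : ℝ) / 2 + α - 1 = n + ((α - 1) + -(n : ℝ) / 2) by ring, Real.rpow_add h1,
        Real.rpow_add h1, Real.rpow_natCast, show 1 - α - 1 = -α by ring]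
      congr 1
      ring
    rw [h2]
    exact ENNReal.mul_ne_top ENNReal.ofReal_ne_top h1.ne
  refine ⟨(∫⁻ u in Ioo (0 : ℝ) 1, a u * ENNReal.ofReal (u ^ (-(n : ℝ) / 2))) ^ 2 *
    ENNReal.ofReal (R ^ (1 - α)) ^ 2, ENNReal.mul_ne_top (ENNReal.pow_ne_top hfin)
      (ENNReal.pow_ne_top ENNReal.ofReal_ne_top), fun φ hφ => ?_⟩
  have hφ1 : ContDiff ℝ 1 φ := hφ.1.of_le (by exact_mod_cast le_top)
  calc ∫⁻ Q, kipriyanovAbs α P φ Q ^ 2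
      ≤ ∫⁻ Q, (∫⁻ u in Ioo 0 1, a u * weightedGradient α P φ (dil P u Q)) ^ 2 :=
        lintegral_mono fun Q => pow_le_pow_left₀ zero_le (kipriyanovAbs_le hn hα hα1 P hφ1 Q) 2
    _ ≤ _ := lintegral_sq_dil_average_le P measurableSet_Ioo (fun u hu => hu.1)
        (by fun_prop) (measurable_weightedGradient α P φ)
    _ ≤ _ := by
        rw [mul_assoc]
        gcongr
        exact lintegral_weightedGradient_sq_le hR hα1 hφ

/-- Common core of the two cases of Hardy's inequality, where φ(Q) is recovered from its gradient on
the ray either outwards (u > 1) or inwards (0 < u < 1). The constant is finite when u^{α-1-n/2} is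
integrable on S. -/
theorem hardy_of_le_average {n : ℕ} {Ω : Set (EuclideanSpace ℝ (Fin n))}
    {P : EuclideanSpace ℝ (Fin n)} {R α : ℝ} (hR : ∀ Q ∈ Ω, dist P Q ≤ R) (hα : 0 < α)
    (hα1 : α < 1) {S : Set ℝ} (hS : MeasurableSet S) (hS0 : ∀ u ∈ S, 0 < u)
    {φ : EuclideanSpace ℝ (Fin n) → ℂ} (hφ : IsTestFunction Ω φ)
    (h : ∀ Q, Q ≠ P →
      ‖φ Q‖ₑ ≤ ENNReal.ofReal (dist P Q) * ∫⁻ u in S, ‖fderiv ℝ φ (dil P u Q)‖ₑ) :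
    ∫⁻ Q, (ENNReal.ofReal (dist P Q ^ (-α)) * ‖φ Q‖ₑ) ^ 2 ≤
      ((∫⁻ u in S, ENNReal.ofReal (u ^ (α - 1 + -(n : ℝ) / 2))) ^ 2 *
        ENNReal.ofReal (R ^ (1 - α)) ^ 2) * ∫⁻ Q, ‖fderiv ℝ φ Q‖ₑ ^ 2 := by
  have hp : ∀ Q, ENNReal.ofReal (dist P Q ^ (-α)) * ‖φ Q‖ₑ ≤
      ∫⁻ u in S, ENNReal.ofReal (u ^ (α - 1)) * weightedGradient α P φ (dil P u Q) := by
    intro Q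
    by_cases hQ : Q = P
    · simp [hQ, Real.zero_rpow (neg_ne_zero.2 hα.ne')]
    calc ENNReal.ofReal (dist P Q ^ (-α)) * ‖φ Q‖ₑ
        ≤ ENNReal.ofReal (dist P Q ^ (-α)) *
          (ENNReal.ofReal (dist P Q) * ∫⁻ u in S, ‖fderiv ℝ φ (dil P u Q)‖ₑ) := by
          gcongr; exact h Q hQ
      _ ≤ ENNReal.ofReal (dist P Q ^ (1 - α)) * ∫⁻ u in S, ‖fderiv ℝ φ (dil P u Q)‖ₑ := by
          rw [← mul_assoc]
          gcongr
          exact ofReal_rpow_neg_mul_le dist_nonneg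
      _ = _ := by
          rw [← lintegral_const_mul' _ _ ENNReal.ofReal_ne_top]
          exact setLIntegral_congr_fun hS fun u hu => dist_rpow_mul_fderiv_dil P φ Q (hS0 u hu)
  calc ∫⁻ Q, (ENNReal.ofReal (dist P Q ^ (-α)) * ‖φ Q‖ₑ) ^ 2
      ≤ ∫⁻ Q, (∫⁻ u in S,
          ENNReal.ofReal (u ^ (α - 1)) * weightedGradient α P φ (dil P u Q)) ^ 2 :=
        lintegral_mono fun Q => pow_le_pow_left₀ zero_le (hp Q) 2
    _ ≤ _ := lintegral_sq_dil_average_le P hS hS0 (by fun_prop)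
        (measurable_weightedGradient α P φ)
    _ ≤ _ := by
        rw [mul_assoc]
        gcongr ?_ ^ 2 * ?_
        · refine (setLIntegral_congr_fun hS fun u hu => ?_).le
          have hu := hS0 u hu
          rw [← ENNReal.ofReal_mul (by positivity), ← Real.rpow_add hu]
        · exact lintegral_weightedGradient_sq_le hR hα1 hφ

/-- A Hardy inequality with the weight `|P - Q|^{-2α}`. -/
theorem exists_hardy_bound {n : ℕ} (hn : 1 ≤ n) {Ω : Set (EuclideanSpace ℝ (Fin n))}
    {P : EuclideanSpace ℝ (Fin n)} (hP : P ∉ Ω) {R α : ℝ} (hR0 : 0 ≤ R)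
    (hR : ∀ Q ∈ Ω, dist P Q ≤ R) (hα : 0 < α) (hα1 : α < 1) :
    ∃ K : ENNReal, K ≠ ⊤ ∧ ∀ φ, IsTestFunction Ω φ →
      ∫⁻ Q, (ENNReal.ofReal (dist P Q ^ (-α)) * ‖φ Q‖ₑ) ^ 2 ≤
        K * ∫⁻ Q, ‖fderiv ℝ φ Q‖ₑ ^ 2 := by
  have hzero : ∀ φ, IsTestFunction Ω φ → ∀ Q ∉ Ω, φ Q = 0 := fun φ hφ Q hQ =>
    image_eq_zero_of_notMem_tsupport fun h => hQ (hφ.2.2 h)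
  have hn1 : (1 : ℝ) ≤ n := by exact_mod_cast hn
  -- For α < n/2 one integrates outwards, where the power u^{α-1-n/2} is integrable at infinity.
  -- Otherwise one integrates inwards, where it has to be integrable at 0.
  by_cases hc : α < (n : ℝ) / 2
  · have hfin : ∫⁻ u in Ioi (1 : ℝ), ENNReal.ofReal (u ^ (α - 1 + -(n : ℝ) / 2)) ≠ ⊤ :=
      (integrableOn_Ioi_rpow_of_lt (by linarith) one_pos).lintegral_lt_top.ne
    refine ⟨_, ENNReal.mul_ne_top (ENNReal.pow_ne_top hfin)
      (ENNReal.pow_ne_top ENNReal.ofReal_ne_top), fun φ hφ => hardy_of_le_average hR hα hα1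
        measurableSet_Ioi (fun u hu => one_pos.trans hu) hφ fun Q hQ => ?_⟩
    have hφ1 : ContDiff ℝ 1 φ := hφ.1.of_le (by exact_mod_cast le_top)
    have hr : 0 < dist P Q := dist_pos.2 (Ne.symm hQ)
    -- Dilating by R/r + 1 puts the point at distance R + r > R from P, hence outside Ω, where φ
    -- vanishes.
    have hb : (1 : ℝ) ≤ R / dist P Q + 1 := by
      have := div_nonneg hR0 hr.le
      linarith
    have h1 := enorm_sub_le_lintegral_fderiv hφ1 P Q hb
    have h2 : φ (dil P (R / dist P Q + 1) Q) = 0 := by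
      refine hzero φ hφ _ fun hmem => ?_
      have := hR _ hmem
      rw [dist_dil P Q (by linarith), add_mul, div_mul_cancel₀ _ hr.ne'] at this
      linarith
    rw [h2, dil_one, zero_sub, enorm_neg] at h1
    refine h1.trans ?_
    gcongr
    exact Ioo_subset_Ioi_self
  -- At α = n/2 the power is u^{-1}, not integrable at 0. A larger exponent α' < 1 avoids this
  -- endpoint, and boundedness of Ω gives r^{-α} ≤ R^{α'-α} r^{-α'}. The inward integral starts from
  -- φ(P) = 0.
  · obtain ⟨α', h1, h2⟩ := exists_between hα1
    have hfin : ∫⁻ u in Ioo (0 : ℝ) 1, ENNReal.ofReal (u ^ (α' - 1 + -(n : ℝ) / 2)) ≠ ⊤ :=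
      ((intervalIntegral.integrableOn_Ioo_rpow_iff one_pos).2 (by linarith)).lintegral_lt_top.ne
    refine ⟨ENNReal.ofReal (R ^ (α' - α)) ^ 2 *
      ((∫⁻ u in Ioo (0 : ℝ) 1, ENNReal.ofReal (u ^ (α' - 1 + -(n : ℝ) / 2))) ^ 2 *
        ENNReal.ofReal (R ^ (1 - α')) ^ 2), ENNReal.mul_ne_top
      (ENNReal.pow_ne_top ENNReal.ofReal_ne_top) (ENNReal.mul_ne_top (ENNReal.pow_ne_top hfin)
      (ENNReal.pow_ne_top ENNReal.ofReal_ne_top)), fun φ hφ => ?_⟩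
    have hφ1 : ContDiff ℝ 1 φ := hφ.1.of_le (by exact_mod_cast le_top)
    have h3 := hardy_of_le_average hR (hα.trans h1) h2
        measurableSet_Ioo (fun u hu => hu.1) hφ fun Q hQ => (by
      have h1 := enorm_sub_le_lintegral_fderiv hφ1 P Q zero_le_one
      rwa [dil_one, dil_zero, hzero φ hφ P hP, sub_zero] at h1)
    rw [mul_assoc]
    refine le_trans ?_ (mul_le_mul_right h3 _)
    rw [← lintegral_const_mul' _ _ (ENNReal.pow_ne_top ENNReal.ofReal_ne_top)]
    refine lintegral_mono fun Q => ?_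
    simp only
    rw [← mul_pow]
    refine pow_le_pow_left₀ zero_le ?_ 2
    by_cases hQ : Q ∈ Ω
    · have hr : 0 < dist P Q := dist_pos.2 fun h => hP (h ▸ hQ)
      rw [← mul_assoc, ← ENNReal.ofReal_mul (by positivity)]
      gcongr
      calc dist P Q ^ (-α) = dist P Q ^ (α' - α) * dist P Q ^ (-α') := by
            rw [← Real.rpow_add hr]; congr 1; ring
        _ ≤ _ := by
            have := hR Q hQ
            gcongr
    · simp [hzero φ hφ Q hQ]

/-! ### From test functions to H₀¹ -/

/-- A function vanishing off `Ω` which is an almost everywhere limit of test functions with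
uniformly bounded Dirichlet integrals. -/
structure IsTestLimit {n : ℕ} (Ω : Set (EuclideanSpace ℝ (Fin n)))
    (f : EuclideanSpace ℝ (Fin n) → ℂ) : Prop where
  measurable : Measurable f
  eq_zero : ∀ x ∉ Ω, f x = 0
  exists_seq : ∃ (φ : ℕ → EuclideanSpace ℝ (Fin n) → ℂ) (C : ENNReal), C ≠ ⊤ ∧
    (∀ k, IsTestFunction Ω (φ k)) ∧ (∀ k, ∫⁻ Q, ‖fderiv ℝ (φ k) Q‖ₑ ^ 2 ≤ C) ∧
    ∀ᵐ x, Tendsto (fun k => φ k x) atTop (𝓝 (f x))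

theorem norm_fderiv_le_sum {n : ℕ} (φ : EuclideanSpace ℝ (Fin n) → ℂ)
    (x : EuclideanSpace ℝ (Fin n)) : ‖fderiv ℝ φ x‖ ≤ ∑ i, ‖partialDeriv i φ x‖ := by
  refine ContinuousLinearMap.opNorm_le_bound _ (Finset.sum_nonneg fun i _ => norm_nonneg _)
    fun v => ?_
  have hv : v = ∑ i, v i • EuclideanSpace.single i (1 : ℝ) := by
    ext j
    simp [Finset.sum_apply, Pi.single_apply]
  calc ‖fderiv ℝ φ x v‖ = ‖∑ i, v i • partialDeriv i φ x‖ := by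
        conv_lhs => rw [hv]
        simp only [map_sum, map_smul, partialDeriv]
    _ ≤ ∑ i, ‖v i • partialDeriv i φ x‖ := norm_sum_le _ _
    _ ≤ ∑ i, ‖partialDeriv i φ x‖ * ‖v‖ := by
        refine Finset.sum_le_sum fun i _ => ?_
        rw [norm_smul, mul_comm]
        gcongr
        exact PiLp.norm_apply_le v i
    _ = _ := by rw [Finset.sum_mul]

theorem measurable_partialDeriv {n : ℕ} (i : Fin n) (φ : EuclideanSpace ℝ (Fin n) → ℂ) :
    Measurable (partialDeriv i φ) :=
  measurable_fderiv_apply_const ℝ φ _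

theorem lintegral_enorm_sq_eq_eLpNorm {X E : Type*} [MeasurableSpace X] [NormedAddCommGroup E]
    {μ : Measure X} (f : X → E) : ∫⁻ x, ‖f x‖ₑ ^ 2 ∂μ = eLpNorm f 2 μ ^ 2 := by
  have := eLpNorm_nnreal_pow_eq_lintegral (f := f) (p := 2) (μ := μ) two_ne_zero
  simp only [NNReal.coe_ofNat, ENNReal.rpow_ofNat] at this
  exact this.symm

theorem lintegral_fderiv_sq_le {n : ℕ} {Ω : Set (EuclideanSpace ℝ (Fin n))}
    {φ : EuclideanSpace ℝ (Fin n) → ℂ} (hφ : IsTestFunction Ω φ) :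
    ∫⁻ Q, ‖fderiv ℝ φ Q‖ₑ ^ 2 ≤ (∑ i, eLpNorm (partialDeriv i φ) 2 (volume.restrict Ω)) ^ 2 := by
  have h0 : ∀ Q ∉ Ω, ‖fderiv ℝ φ Q‖ₑ ^ 2 = 0 := by
    intro Q hQ
    have h0 : fderiv ℝ φ Q = 0 := by
      by_contra h
      exact hQ (hφ.2.2 (support_fderiv_subset ℝ h))
    rw [← ofReal_norm, h0, norm_zero, ENNReal.ofReal_zero, zero_pow two_ne_zero]
  rw [← setLIntegral_eq_of_support_subset (s := Ω) (fun Q hQ => by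
    by_contra h; exact hQ (h0 Q h)), lintegral_enorm_sq_eq_eLpNorm]
  refine pow_le_pow_left₀ zero_le ?_ 2
  calc eLpNorm (fderiv ℝ φ) 2 (volume.restrict Ω)
      ≤ eLpNorm (∑ i, fun x => ‖partialDeriv i φ x‖) 2 (volume.restrict Ω) := by
        refine eLpNorm_mono_real fun x => ?_
        simpa using norm_fderiv_le_sum φ x
    _ ≤ ∑ i, eLpNorm (fun x => ‖partialDeriv i φ x‖) 2 (volume.restrict Ω) :=
        eLpNorm_sum_le (fun i _ => (measurable_partialDeriv i φ).norm.aestronglyMeasurable)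
          one_le_two
    _ = _ := by simp only [eLpNorm_norm]

/-- Convergence in L₂ gives a subsequence converging almost everywhere, and convergence of the
partial derivatives bounds the Dirichlet integrals from some index N on; hence the shift by N. The
limit is a measurable representative extended by zero. -/
theorem MemH10.exists_isTestLimit {n : ℕ} {Ω : Set (EuclideanSpace ℝ (Fin n))} (hΩ : IsOpen Ω)
    {f : EuclideanSpace ℝ (Fin n) → ℂ} (hf : MemH10 Ω f) :
    ∃ f', IsTestLimit Ω f' ∧ MemLp f' 2 ∧ ∀ᵐ x, x ∈ Ω → f x = f' x := by
  obtain ⟨hf2, g, hg, φ, hφ, hlim, hdlim⟩ := hf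
  have hae : f =ᵐ[volume.restrict Ω] hf2.1.mk f := hf2.1.ae_eq_mk
  have hφc : ∀ k, Continuous (φ k) := fun k => (hφ k).1.continuous
  obtain ⟨ns, hns, hns2⟩ := (tendstoInMeasure_of_tendsto_eLpNorm two_ne_zero
    (fun k => (hφc k).aestronglyMeasurable) hf2.1 hlim).exists_seq_tendsto_ae
  have hb : ∀ i, ∀ᶠ k in atTop, eLpNorm (partialDeriv i (φ k)) 2 (volume.restrict Ω) ≤
      1 + eLpNorm (g i) 2 (volume.restrict Ω) := by
    intro i
    filter_upwards [(hdlim i).eventually (ge_mem_nhds one_pos)] with k hk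
    calc eLpNorm (partialDeriv i (φ k)) 2 (volume.restrict Ω)
        = eLpNorm ((partialDeriv i (φ k) - g i) + g i) 2 (volume.restrict Ω) := by
          rw [sub_add_cancel]
      _ ≤ _ := eLpNorm_add_le
          ((measurable_partialDeriv i (φ k)).aestronglyMeasurable.sub (hg i).1.1) (hg i).1.1
          one_le_two
      _ ≤ _ := by gcongr
  obtain ⟨N, hN⟩ := eventually_atTop.1 (eventually_all.2 hb)
  refine ⟨Ω.indicator (hf2.1.mk f), ⟨?_, ?_, fun k => φ (ns (k + N)),
    (∑ i, (1 + eLpNorm (g i) 2 (volume.restrict Ω))) ^ 2, ?_, fun k => hφ _, fun k => ?_, ?_⟩,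
    ?_, ?_⟩
  · exact hf2.1.stronglyMeasurable_mk.measurable.indicator hΩ.measurableSet
  · intro x hx
    simp [hx]
  · refine ENNReal.pow_ne_top (ENNReal.sum_ne_top.2 fun i _ => ?_)
    exact ENNReal.add_ne_top.2 ⟨ENNReal.one_ne_top, (hg i).1.2.ne⟩
  · refine (lintegral_fderiv_sq_le (hφ _)).trans ?_
    gcongr with i
    exact hN _ ((Nat.le_add_left N k).trans (hns.id_le _)) i
  · filter_upwards [(ae_restrict_iff' hΩ.measurableSet).1 hns2,
      (ae_restrict_iff' hΩ.measurableSet).1 hae] with x hx1 hx2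
    by_cases hx : x ∈ Ω
    · rw [indicator_of_mem hx, ← hx2 hx]
      exact (hx1 hx).comp (tendsto_add_atTop_nat N)
    · rw [indicator_of_notMem hx]
      refine tendsto_const_nhds.congr fun k => ?_
      exact (image_eq_zero_of_notMem_tsupport fun h => hx ((hφ _).2.2 h)).symm
  · exact (memLp_indicator_iff_restrict hΩ.measurableSet).2 (hf2.ae_eq hae)
  · filter_upwards [(ae_restrict_iff' hΩ.measurableSet).1 hae] with x hx1 hx
    rw [indicator_of_mem hx, hx1 hx]

/-- A property that holds almost everywhere holds almost everywhere along almost every ray. -/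
theorem ae_ae_dil {n : ℕ} (P : EuclideanSpace ℝ (Fin n)) {p : EuclideanSpace ℝ (Fin n) → Prop}
    (hp : ∀ᵐ x, p x) : ∀ᵐ Q, ∀ᵐ s ∂(volume.restrict (Ioo (0 : ℝ) 1)), p (dil P s Q) := by
  -- A homothety of positive ratio pulls null sets back to null sets, so Tonelli in (Q, s) gives the
  -- claim; a measurable null superset makes Tonelli applicable.
  obtain ⟨N, hN, hNm, hN0⟩ := exists_measurable_superset_of_null (ae_iff.1 hp)
  have hm : Measurable (fun z : EuclideanSpace ℝ (Fin n) × ℝ =>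
      N.indicator (1 : EuclideanSpace ℝ (Fin n) → ENNReal) (dil P z.2 z.1)) :=
    (measurable_one.indicator hNm).comp
      (by fun_prop : Measurable fun z : EuclideanSpace ℝ (Fin n) × ℝ => dil P z.2 z.1)
  have h0 : ∫⁻ Q, ∫⁻ s in Ioo (0 : ℝ) 1,
      N.indicator (1 : EuclideanSpace ℝ (Fin n) → ENNReal) (dil P s Q) = 0 := by
    rw [lintegral_lintegral_swap hm.aemeasurable]
    refine (setLIntegral_congr_fun measurableSet_Ioo fun s hs => ?_).trans lintegral_zero
    rw [lintegral_comp_dil P hs.1 (measurable_one.indicator hNm), lintegral_indicator_one hNm,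
      hN0, mul_zero]
  rw [lintegral_eq_zero_iff hm.lintegral_prod_right'] at h0
  filter_upwards [h0] with Q hQ
  have hQ' := (lintegral_eq_zero_iff (hm.comp measurable_prodMk_left)).1 hQ
  filter_upwards [hQ'] with s hs
  by_contra h
  have : dil P s Q ∈ N := hN h
  simp [this] at hs

theorem liminf_sq_eq (u : ℕ → ENNReal) :
    liminf u atTop ^ 2 = liminf (fun k => u k ^ 2) atTop :=
  Monotone.map_liminf_of_continuousAt (F := atTop) (f := fun x : ENNReal => x ^ 2)
    (fun _ _ h => pow_le_pow_left₀ zero_le h 2) u (ENNReal.continuous_pow 2).continuousAt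

@[fun_prop]
theorem measurable_kipriyanovAbs {n : ℕ} {α : ℝ} {P : EuclideanSpace ℝ (Fin n)}
    {f : EuclideanSpace ℝ (Fin n) → ℂ} (hf : Measurable f) : Measurable (kipriyanovAbs α P f) := by
  unfold kipriyanovAbs
  have : Measurable (fun z : EuclideanSpace ℝ (Fin n) × ℝ =>
      ENNReal.ofReal (kipriyanovKernel n α z.2) * ‖f z.1 - f (dil P z.2 z.1)‖ₑ) := by fun_prop
  exact (by fun_prop : Measurable fun Q => ENNReal.ofReal (dist P Q ^ (-α))).mul
    this.lintegral_prod_right'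

/-- Fatou is applied twice: in s for almost every Q, using that convergence also holds almost
everywhere along almost every ray, and then in Q. -/
theorem IsTestLimit.lintegral_kipriyanovAbs_sq_lt_top {n : ℕ} (hn : 1 ≤ n)
    {Ω : Set (EuclideanSpace ℝ (Fin n))} {P : EuclideanSpace ℝ (Fin n)} {R α : ℝ}
    (hR : ∀ Q ∈ Ω, dist P Q ≤ R) (hα : 0 < α) (hα1 : α < 1)
    {f : EuclideanSpace ℝ (Fin n) → ℂ} (hf : IsTestLimit Ω f) :
    ∫⁻ Q, kipriyanovAbs α P f Q ^ 2 < ⊤ := by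
  obtain ⟨φ, C, hC, hφ, hφC, hlim⟩ := hf.exists_seq
  obtain ⟨K, hK, hKφ⟩ := exists_kipriyanovAbs_bound hn hR hα hα1
  have hm : ∀ k, Measurable (φ k) := fun k => (hφ k).1.continuous.measurable
  have hle : ∀ᵐ Q, kipriyanovAbs α P f Q ≤ liminf (fun k => kipriyanovAbs α P (φ k) Q) atTop := by
    filter_upwards [hlim, ae_ae_dil P hlim] with Q hQ hQs
    unfold kipriyanovAbs
    simp only [← lintegral_const_mul' _ _ (ENNReal.ofReal_ne_top (r := dist P Q ^ (-α)))]
    refine le_trans ?_ (lintegral_liminf_le fun k => by have := hm k; fun_prop)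
    refine lintegral_mono_ae ?_
    filter_upwards [hQs] with s hs
    refine le_of_eq (Tendsto.liminf_eq ?_).symm
    exact ENNReal.Tendsto.const_mul (ENNReal.Tendsto.const_mul (hQ.sub hs).enorm
      (Or.inr ENNReal.ofReal_ne_top)) (Or.inr ENNReal.ofReal_ne_top)
  calc ∫⁻ Q, kipriyanovAbs α P f Q ^ 2
      ≤ ∫⁻ Q, liminf (fun k => kipriyanovAbs α P (φ k) Q ^ 2) atTop := by
        refine lintegral_mono_ae ?_
        filter_upwards [hle] with Q hQ
        rw [← liminf_sq_eq]
        gcongr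
    _ ≤ liminf (fun k => ∫⁻ Q, kipriyanovAbs α P (φ k) Q ^ 2) atTop :=
        lintegral_liminf_le fun k => by have := hm k; fun_prop
    _ ≤ K * C := by
        refine liminf_le_of_le (by isBoundedDefault) fun b hb => ?_
        obtain ⟨k, hk⟩ := hb.exists
        exact hk.trans ((hKφ _ (hφ k)).trans (by gcongr; exact hφC k))
    _ < ⊤ := (ENNReal.mul_ne_top hK hC).lt_top

theorem IsTestLimit.lintegral_hardy_lt_top {n : ℕ} (hn : 1 ≤ n)
    {Ω : Set (EuclideanSpace ℝ (Fin n))} {P : EuclideanSpace ℝ (Fin n)} {R α : ℝ}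
    (hP : P ∉ Ω) (hR0 : 0 ≤ R) (hR : ∀ Q ∈ Ω, dist P Q ≤ R) (hα : 0 < α) (hα1 : α < 1)
    {f : EuclideanSpace ℝ (Fin n) → ℂ} (hf : IsTestLimit Ω f) :
    ∫⁻ Q, (ENNReal.ofReal (dist P Q ^ (-α)) * ‖f Q‖ₑ) ^ 2 < ⊤ := by
  obtain ⟨φ, C, hC, hφ, hφC, hlim⟩ := hf.exists_seq
  obtain ⟨K, hK, hKφ⟩ := exists_hardy_bound hn hP hR0 hR hα hα1
  have hm : ∀ k, Measurable (φ k) := fun k => (hφ k).1.continuous.measurable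
  calc ∫⁻ Q, (ENNReal.ofReal (dist P Q ^ (-α)) * ‖f Q‖ₑ) ^ 2
      ≤ ∫⁻ Q, liminf (fun k => (ENNReal.ofReal (dist P Q ^ (-α)) * ‖φ k Q‖ₑ) ^ 2) atTop := by
        refine lintegral_mono_ae ?_
        filter_upwards [hlim] with Q hQ
        refine le_of_eq (Tendsto.liminf_eq ?_).symm
        exact ((ENNReal.continuous_pow 2).tendsto _).comp
          (ENNReal.Tendsto.const_mul hQ.enorm (Or.inr ENNReal.ofReal_ne_top))
    _ ≤ liminf (fun k => ∫⁻ Q, (ENNReal.ofReal (dist P Q ^ (-α)) * ‖φ k Q‖ₑ) ^ 2) atTop :=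
        lintegral_liminf_le fun k => by have := hm k; fun_prop
    _ ≤ K * C := by
        refine liminf_le_of_le (by isBoundedDefault) fun b hb => ?_
        obtain ⟨k, hk⟩ := hb.exists
        exact hk.trans ((hKφ _ (hφ k)).trans (by gcongr; exact hφC k))
    _ < ⊤ := (ENNReal.mul_ne_top hK hC).lt_top

/-! ### Radial integrals left by the change of variables -/

theorem integral_comp_dil {n : ℕ} (P : EuclideanSpace ℝ (Fin n)) {s : ℝ} (hs : 0 < s)
    (h : EuclideanSpace ℝ (Fin n) → ℝ) :
    ∫ Q, h (dil P s Q) = s ^ (-(n : ℝ)) * ∫ Q, h Q := by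
  unfold dil
  rw [integral_sub_right_eq_self (μ := volume) (fun Q => h (P + s • Q)) P,
    Measure.integral_comp_smul volume (fun Q => h (P + Q)) s,
    integral_add_left_eq_self (μ := volume) h P, finrank_euclideanSpace_fin,
    abs_of_pos (by positivity), Real.rpow_neg hs.le, Real.rpow_natCast, smul_eq_mul]

theorem integrable_comp_dil {n : ℕ} (P : EuclideanSpace ℝ (Fin n)) {s : ℝ} (hs : 0 < s)
    {h : EuclideanSpace ℝ (Fin n) → ℝ} (hh : Integrable h) :
    Integrable (fun Q => h (dil P s Q)) :=
  ((hh.comp_add_left P).comp_smul hs.ne').comp_sub_right P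

/-- Fubini, then `integral_tail_kernel` for each T with lower limit |P - T|/R. The factor |P - T|^β
cancels the one in the denominator, and (1 - |P - T|/R)^β ≤ 1 is discarded. -/
theorem radial_tail_le {n : ℕ} (P : EuclideanSpace ℝ (Fin n)) {R β : ℝ} (hR : 0 < R) (hβ : 0 < β)
    {F : EuclideanSpace ℝ (Fin n) → ℝ} (hFm : Measurable F) (hF : Integrable F)
    (hF0 : ∀ T, 0 ≤ F T) (hFR : ∀ T, F T ≠ 0 → 0 < dist P T ∧ dist P T ≤ R) :
    IntegrableOn (fun s : ℝ => (1 - s) ^ (β - 1) * s ^ (-1 - β) *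
      ∫ T, if dist P T ≤ s * R then dist P T ^ β * F T else 0) (Ioo 0 1) ∧
    ∫ s in Ioo (0 : ℝ) 1, ((1 - s) ^ (β - 1) * s ^ (-1 - β) *
      ∫ T, if dist P T ≤ s * R then dist P T ^ β * F T else 0) ≤ R ^ β / β * ∫ T, F T := by
  set q : EuclideanSpace ℝ (Fin n) × ℝ → ℝ := fun z => (1 - z.2) ^ (β - 1) * z.2 ^ (-1 - β) *
    (if dist P z.1 ≤ z.2 * R then dist P z.1 ^ β * F z.1 else 0) with hq
  have hqm : Measurable q := by
    refine Measurable.mul (by fun_prop) (Measurable.ite ?_ (by fun_prop) (by fun_prop))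
    exact measurableSet_le (by fun_prop) (by fun_prop)
  have hq0 : ∀ T, ∀ s ∈ Ioo (0 : ℝ) 1, 0 ≤ q (T, s) := by
    intro T s hs
    have h1 := hs.1
    have h2 : 0 < 1 - s := by linarith [hs.2]
    have := hF0 T
    simp only [hq]
    split_ifs <;> positivity
  have hinner : ∀ T, IntegrableOn (fun s => q (T, s)) (Ioo 0 1) ∧
      ∫ s in Ioo (0 : ℝ) 1, q (T, s) ≤ R ^ β / β * F T := by
    intro T
    by_cases hT : F T = 0
    · simp [hq, hT]
    obtain ⟨h1, h2⟩ := hFR T hT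
    have hτ : 0 < dist P T / R := div_pos h1 hR
    have hτ1 : dist P T / R ≤ 1 := (div_le_one hR).2 h2
    obtain ⟨hi, hv⟩ := integral_tail_kernel hβ hτ hτ1
    have he : EqOn (fun s => q (T, s)) ((Ico (dist P T / R) 1).indicator fun s =>
        (1 - s) ^ (β - 1) * s ^ (-1 - β) * (dist P T ^ β * F T)) (Ioo 0 1) := by
      intro s hs
      simp only [hq, indicator, mem_Ico, div_le_iff₀ hR, hs.2, and_true]
      split_ifs <;> simp
    have hsub : Ioo (0 : ℝ) 1 ∩ Ico (dist P T / R) 1 = Ico (dist P T / R) 1 :=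
      inter_eq_right.2 fun s hs => ⟨hτ.trans_le hs.1, hs.2⟩
    have hi' : IntegrableOn (fun s : ℝ => (1 - s) ^ (β - 1) * s ^ (-1 - β) *
        (dist P T ^ β * F T)) (Ico (dist P T / R) 1) :=
      ((integrableOn_Ico_iff_integrableOn_Ioo enorm_ne_top).2
        (hi.mono_set Ioo_subset_Ioc_self)).mul_const _
    constructor
    · refine IntegrableOn.congr_fun ?_ he.symm measurableSet_Ioo
      exact ((integrable_indicator_iff measurableSet_Ico).2 hi').integrableOn
    · rw [setIntegral_congr_fun measurableSet_Ioo he, setIntegral_indicator measurableSet_Ico, hsub,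
        integral_mul_const, integral_Ico_eq_integral_Ioo, ← integral_Ioc_eq_integral_Ioo, hv,
        Real.div_rpow (by linarith) hτ.le, Real.div_rpow h1.le hR.le]
      have h3 : (1 - dist P T / R) ^ β ≤ 1 := Real.rpow_le_one (by linarith) (by linarith) hβ.le
      have := hF0 T
      calc (1 - dist P T / R) ^ β / (dist P T ^ β / R ^ β) / β * (dist P T ^ β * F T)
          = (1 - dist P T / R) ^ β * (R ^ β / β * F T) := by
            have : dist P T ^ β ≠ 0 := by positivity
            field_simp
        _ ≤ 1 * (R ^ β / β * F T) := by gcongr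
        _ = _ := one_mul _
  have hint : Integrable q (volume.prod (volume.restrict (Ioo (0 : ℝ) 1))) := by
    refine (integrable_prod_iff hqm.aestronglyMeasurable).2
      ⟨ae_of_all _ fun T => (hinner T).1, ?_⟩
    refine (hF.const_mul (R ^ β / β)).mono'
      hqm.norm.stronglyMeasurable.integral_prod_right'.aestronglyMeasurable
      (ae_of_all _ fun T => ?_)
    rw [Real.norm_of_nonneg (integral_nonneg fun s => norm_nonneg _)]
    refine le_trans (le_of_eq ?_) (hinner T).2
    exact setIntegral_congr_fun measurableSet_Ioo fun s hs => Real.norm_of_nonneg (hq0 T s hs)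
  have hswap : ∀ s : ℝ, (1 - s) ^ (β - 1) * s ^ (-1 - β) *
      (∫ T, if dist P T ≤ s * R then dist P T ^ β * F T else 0) = ∫ T, q (T, s) := by
    intro s
    rw [← integral_const_mul]
  simp only [hswap]
  refine ⟨hint.integral_prod_right, ?_⟩
  have hsw := integral_integral_swap (f := fun T s => q (T, s)) hint
  rw [← hsw, ← integral_const_mul]
  exact integral_mono hint.integral_prod_left (hF.const_mul _) fun T => (hinner T).2

/-- For fixed T the condition s R < |P - T| restricts s to (0, |P - T|/R), on which s^{α-1}
integrates explicitly. With A(T) = w(T) |P - T|^{-α} |f(T)|² the powers of |P - T| cancel, leaving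
R^{-α}/α times w |f|². -/
theorem radial_head_eq {n : ℕ} (P : EuclideanSpace ℝ (Fin n)) {R α : ℝ} (hR : 0 < R) (hα : 0 < α)
    {A : EuclideanSpace ℝ (Fin n) → ℝ} (hAm : Measurable A) (hA : Integrable A)
    (hAR : ∀ T, A T ≠ 0 → dist P T ≤ R) :
    IntegrableOn (fun s : ℝ => s ^ (α - 1) * ∫ T, if s * R < dist P T then A T else 0) (Ioo 0 1) ∧
    ∫ s in Ioo (0 : ℝ) 1, (s ^ (α - 1) * ∫ T, if s * R < dist P T then A T else 0) =
      ∫ T, (dist P T / R) ^ α / α * A T := by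
  set q : EuclideanSpace ℝ (Fin n) × ℝ → ℝ := fun z => z.2 ^ (α - 1) *
    (if z.2 * R < dist P z.1 then A z.1 else 0) with hq
  have hqm : Measurable q := by
    refine Measurable.mul (by fun_prop) (Measurable.ite ?_ (by fun_prop) (by fun_prop))
    exact measurableSet_lt (by fun_prop) (by fun_prop)
  have hs1 : IntegrableOn (fun s : ℝ => s ^ (α - 1)) (Ioo 0 1) :=
    (intervalIntegral.integrableOn_Ioo_rpow_iff one_pos).2 (by linarith)
  have hint : Integrable q (volume.prod (volume.restrict (Ioo (0 : ℝ) 1))) := by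
    refine (hA.mul_prod hs1).mono hqm.aestronglyMeasurable (ae_of_all _ fun z => ?_)
    simp only [hq, norm_mul]
    rw [mul_comm]
    gcongr
    split_ifs <;> simp
  have hinner : ∀ T, ∫ s in Ioo (0 : ℝ) 1, q (T, s) = (dist P T / R) ^ α / α * A T := by
    intro T
    by_cases hT : A T = 0
    · simp [hq, hT]
    have hτ : 0 ≤ dist P T / R := by positivity
    have hτ1 : dist P T / R ≤ 1 := (div_le_one hR).2 (hAR T hT)
    have he : EqOn (fun s => q (T, s)) ((Ioo 0 (dist P T / R)).indicator fun s =>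
        s ^ (α - 1) * A T) (Ioo 0 1) := by
      intro s hs
      simp only [hq, indicator, mem_Ioo, lt_div_iff₀ hR, hs.1, true_and]
      split_ifs <;> simp
    rw [setIntegral_congr_fun measurableSet_Ioo he, setIntegral_indicator measurableSet_Ioo,
      inter_eq_right.2 (Ioo_subset_Ioo_right hτ1), integral_mul_const,
      ← integral_Ioc_eq_integral_Ioo, integral_rpow_sub_one hα hτ]
  have hswap : ∀ s : ℝ, s ^ (α - 1) * (∫ T, if s * R < dist P T then A T else 0) =
      ∫ T, q (T, s) := by
    intro s
    rw [← integral_const_mul]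
  simp only [hswap]
  refine ⟨hint.integral_prod_right, ?_⟩
  have hsw := integral_integral_swap (f := fun T s => q (T, s)) hint
  rw [← hsw]
  exact integral_congr_ae (ae_of_all _ hinner)

theorem lintegral_mul_lt_top_of_sq {X : Type*} [MeasurableSpace X] {μ : Measure X}
    {u v : X → ENNReal} (hu : Measurable u) (hv : Measurable v)
    (hu2 : ∫⁻ x, u x ^ 2 ∂μ < ⊤) (hv2 : ∫⁻ x, v x ^ 2 ∂μ < ⊤) : ∫⁻ x, u x * v x ∂μ < ⊤ := by
  have h := (sq_lintegral_mul_le hu.aemeasurable hv.aemeasurable).trans_lt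
    (ENNReal.mul_lt_top hu2 hv2)
  exact ENNReal.pow_lt_top_iff.1 h |>.resolve_right two_ne_zero

theorem MeasureTheory.MemLp.lintegral_enorm_sq_lt_top {X E : Type*} [MeasurableSpace X]
    [NormedAddCommGroup E] {μ : Measure X} {f : X → E} (hf : MemLp f 2 μ) : ∫⁻ x, ‖f x‖ₑ ^ 2 ∂μ < ⊤ := by
  rw [lintegral_enorm_sq_eq_eLpNorm]
  exact ENNReal.pow_lt_top hf.2

/-! ### The energy density of the fractional integral -/

/-- The integral part of the Kipriyanov derivative, in terms of dilations. -/
noncomputable def kipriyanovIntegral {n : ℕ} (α : ℝ) (P : EuclideanSpace ℝ (Fin n))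
    (f : EuclideanSpace ℝ (Fin n) → ℂ) (Q : EuclideanSpace ℝ (Fin n)) : ℂ :=
  dist P Q ^ (-α) • ∫ s in Ioo (0 : ℝ) 1, kipriyanovKernel n α s • (f Q - f (dil P s Q))

theorem integrableOn_kernel_smul {n : ℕ} {α : ℝ} {P Q : EuclideanSpace ℝ (Fin n)} (hQ : Q ≠ P)
    {f : EuclideanSpace ℝ (Fin n) → ℂ} (hf : Measurable f) (h : kipriyanovAbs α P f Q < ⊤) :
    IntegrableOn (fun s => kipriyanovKernel n α s • (f Q - f (dil P s Q))) (Ioo 0 1) := by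
  have hr : 0 < dist P Q := dist_pos.2 (Ne.symm hQ)
  have h0 : ENNReal.ofReal (dist P Q ^ (-α)) ≠ 0 := by
    rw [Ne, ENNReal.ofReal_eq_zero, not_le]; positivity
  refine ⟨(by fun_prop : Measurable _).aestronglyMeasurable, ?_⟩
  have h1 := ENNReal.lt_top_of_mul_ne_top_right h.ne h0
  refine lt_of_le_of_lt (setLIntegral_mono' measurableSet_Ioo fun s hs => ?_) h1
  rw [enorm_smul, Real.enorm_of_nonneg (kipriyanovKernel_pos hs).le]

theorem enorm_kipriyanovIntegral_le {n : ℕ} {α : ℝ} (P : EuclideanSpace ℝ (Fin n))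
    (f : EuclideanSpace ℝ (Fin n) → ℂ) (Q : EuclideanSpace ℝ (Fin n)) :
    ‖kipriyanovIntegral α P f Q‖ₑ ≤ kipriyanovAbs α P f Q := by
  unfold kipriyanovIntegral kipriyanovAbs
  rw [enorm_smul, Real.enorm_of_nonneg (by positivity)]
  gcongr
  refine (enorm_integral_le_lintegral_enorm _).trans
    (setLIntegral_mono' measurableSet_Ioo fun s hs => ?_)
  rw [enorm_smul, Real.enorm_of_nonneg (kipriyanovKernel_pos hs).le]

theorem measurable_kipriyanovIntegral {n : ℕ} {α : ℝ} {P : EuclideanSpace ℝ (Fin n)}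
    {f : EuclideanSpace ℝ (Fin n) → ℂ} (hf : Measurable f) :
    Measurable (kipriyanovIntegral α P f) := by
  have : Measurable (fun z : EuclideanSpace ℝ (Fin n) × ℝ =>
      kipriyanovKernel n α z.2 • (f z.1 - f (dil P z.2 z.1))) := by fun_prop
  exact (by fun_prop : Measurable fun Q => dist P Q ^ (-α)).smul
    this.stronglyMeasurable.integral_prod_right'.measurable

/-- A bounded weight supported in `Ω` whose growth along the rays from `P` is controlled. -/
structure IsRadialWeight {n : ℕ} (Ω : Set (EuclideanSpace ℝ (Fin n)))
    (P : EuclideanSpace ℝ (Fin n)) (M lam : ℝ) (w : EuclideanSpace ℝ (Fin n) → ℝ) : Prop where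
  measurable : Measurable w
  nonneg : ∀ Q, 0 ≤ w Q
  bounded : ∃ B, ∀ Q, w Q ≤ B
  eq_zero : ∀ Q ∉ Ω, w Q = 0
  growth : ∀ Q ∈ Ω, ∀ s ∈ Ioo (0 : ℝ) 1, w Q ≤ w (dil P s Q) + M * ((1 - s) * dist P Q) ^ lam

section
variable {n : ℕ} {Ω : Set (EuclideanSpace ℝ (Fin n))} {P : EuclideanSpace ℝ (Fin n)}
  {R α lam M : ℝ} {w : EuclideanSpace ℝ (Fin n) → ℝ} {f : EuclideanSpace ℝ (Fin n) → ℂ}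

theorem IsRadialWeight.integrable_mul (hw : IsRadialWeight Ω P M lam w)
    {u : EuclideanSpace ℝ (Fin n) → ℝ} (hu : Integrable u) : Integrable (fun Q => w Q * u Q) := by
  obtain ⟨B, hB⟩ := hw.bounded
  refine hu.bdd_mul (c := B) hw.measurable.aestronglyMeasurable (ae_of_all _ fun Q => ?_)
  rw [Real.norm_of_nonneg (hw.nonneg Q)]
  exact hB Q

/-- Cauchy–Schwarz for |f| and r^{-α} |f|, the latter square integrable by Hardy's inequality. -/
theorem integrable_normSq_mul_dist_rpow (hn : 1 ≤ n) (hP : P ∉ Ω) (hR0 : 0 ≤ R)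
    (hR : ∀ Q ∈ Ω, dist P Q ≤ R) (hα : 0 < α) (hα1 : α < 1) (hf : IsTestLimit Ω f)
    (hf2 : MemLp f 2) : Integrable (fun Q => dist P Q ^ (-α) * ‖f Q‖ ^ 2) := by
  have hfm := hf.measurable
  refine ⟨(by fun_prop : Measurable _).aestronglyMeasurable, ?_⟩
  have h := lintegral_mul_lt_top_of_sq hfm.enorm
    (by fun_prop : Measurable fun Q => ENNReal.ofReal (dist P Q ^ (-α)) * ‖f Q‖ₑ)
    hf2.lintegral_enorm_sq_lt_top (hf.lintegral_hardy_lt_top hn hP hR0 hR hα hα1)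
  refine lt_of_le_of_lt (lintegral_mono fun Q => ?_) h
  rw [enorm_mul, Real.enorm_of_nonneg (by positivity), enorm_pow, enorm_norm]
  exact le_of_eq (by ring)

/-- The energy density of the integral part of the Kipriyanov derivative. -/
noncomputable def energyDensity (α : ℝ) (P : EuclideanSpace ℝ (Fin n))
    (w : EuclideanSpace ℝ (Fin n) → ℝ) (f : EuclideanSpace ℝ (Fin n) → ℂ)
    (Q : EuclideanSpace ℝ (Fin n)) (s : ℝ) : ℝ :=
  w Q * (dist P Q ^ (-α) * (kipriyanovKernel n α s * inner ℝ (f Q) (f Q - f (dil P s Q))))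

/-- The s-integral of the absolute value is at most B |f| `kipriyanovAbs`, a product of two L₂
functions. Fubini is therefore available on the whole of (0, 1), with no truncation at the
singularity s = 1. -/
theorem integrable_energyDensity (hn : 1 ≤ n) (hR : ∀ Q ∈ Ω, dist P Q ≤ R) (hα : 0 < α)
    (hα1 : α < 1) (hw : IsRadialWeight Ω P M lam w) (hf : IsTestLimit Ω f) (hf2 : MemLp f 2) :
    Integrable (Function.uncurry (energyDensity α P w f))
      (volume.prod (volume.restrict (Ioo (0 : ℝ) 1))) := by
  obtain ⟨B, hB⟩ := hw.bounded
  have hfm := hf.measurable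
  have hwm := hw.measurable
  have hm : Measurable (Function.uncurry (energyDensity α P w f)) := by
    unfold energyDensity Function.uncurry
    simp only
    fun_prop
  refine ⟨hm.aestronglyMeasurable, ?_⟩
  have h := lintegral_mul_lt_top_of_sq hfm.enorm (measurable_kipriyanovAbs (α := α) (P := P) hfm)
    hf2.lintegral_enorm_sq_lt_top (hf.lintegral_kipriyanovAbs_sq_lt_top hn hR hα hα1)
  rw [HasFiniteIntegral, lintegral_prod _ hm.enorm.aemeasurable]
  refine lt_of_le_of_lt (lintegral_mono fun Q => ?_)
    ((lintegral_const_mul' _ _ ENNReal.ofReal_ne_top).trans_lt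
      (ENNReal.mul_lt_top (ENNReal.ofReal_lt_top (r := B)) h))
  unfold kipriyanovAbs
  rw [← lintegral_const_mul' _ _ ENNReal.ofReal_ne_top, ← lintegral_const_mul' _ _ enorm_ne_top,
    ← lintegral_const_mul' _ _ ENNReal.ofReal_ne_top]
  refine setLIntegral_mono' measurableSet_Ioo fun s hs => ?_
  simp only [Function.uncurry, energyDensity, enorm_mul]
  rw [Real.enorm_of_nonneg (hw.nonneg Q), Real.enorm_of_nonneg (kipriyanovKernel_pos hs).le,
    Real.enorm_of_nonneg (by positivity : 0 ≤ dist P Q ^ (-α)),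
    mul_left_comm ‖f Q‖ₑ, mul_left_comm ‖f Q‖ₑ]
  gcongr
  · exact hB Q
  · rw [← ofReal_norm, ← ofReal_norm, ← ofReal_norm, ← ENNReal.ofReal_mul (norm_nonneg _)]
    exact ENNReal.ofReal_le_ofReal (norm_inner_le_norm _ _)

theorem integral_energyDensity_eq (hn : 1 ≤ n) (hP : P ∉ Ω) (hR : ∀ Q ∈ Ω, dist P Q ≤ R)
    (hα : 0 < α) (hα1 : α < 1) (hw : IsRadialWeight Ω P M lam w) (hf : IsTestLimit Ω f) :
    ∀ᵐ Q, ∫ s in Ioo (0 : ℝ) 1, energyDensity α P w f Q s =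
      w Q * inner ℝ (f Q) (kipriyanovIntegral α P f Q) := by
  have hfm := hf.measurable
  have h := ae_lt_top ((measurable_kipriyanovAbs (α := α) (P := P) hfm).pow_const 2)
    (hf.lintegral_kipriyanovAbs_sq_lt_top hn hR hα hα1).ne
  filter_upwards [h] with Q hQ
  by_cases hQΩ : Q ∈ Ω
  · have hQP : Q ≠ P := fun h => hP (h ▸ hQΩ)
    have hQ' : kipriyanovAbs α P f Q < ⊤ :=
      (ENNReal.pow_lt_top_iff.1 hQ).resolve_right two_ne_zero
    have hi := integrableOn_kernel_smul hQP hfm hQ'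
    unfold energyDensity kipriyanovIntegral
    rw [integral_const_mul, integral_const_mul, inner_smul_right]
    congr 2
    rw [← integral_inner hi]
    simp only [inner_smul_right]
  · simp [energyDensity, hw.eq_zero Q hQΩ]

/-- The two sides differ by |a - b|²/2. -/
theorem half_normSq_sub_le_inner (a b : ℂ) :
    (‖a‖ ^ 2 - ‖b‖ ^ 2) / 2 ≤ inner ℝ a (a - b) := by
  rw [inner_sub_right, real_inner_self_eq_norm_sq]
  have := norm_sub_sq_real a b
  nlinarith [sq_nonneg ‖a - b‖]

/-- Pointwise lower bound of the energy density. -/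
theorem energyDensity_ge (hP : P ∉ Ω) (hR : ∀ Q ∈ Ω, dist P Q ≤ R) (hM : 0 ≤ M)
    (hw : IsRadialWeight Ω P M lam w) (Q : EuclideanSpace ℝ (Fin n)) {s : ℝ}
    (hs : s ∈ Ioo (0 : ℝ) 1) :
    kipriyanovKernel n α s *
      (w Q * (dist P Q ^ (-α) * ‖f Q‖ ^ 2) -
        s ^ α * (if dist P (dil P s Q) ≤ s * R then
          w (dil P s Q) * (dist P (dil P s Q) ^ (-α) * ‖f (dil P s Q)‖ ^ 2) else 0) -
        M * (1 - s) ^ lam * s ^ (α - lam) * (if dist P (dil P s Q) ≤ s * R then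
          dist P (dil P s Q) ^ (lam - α) * ‖f (dil P s Q)‖ ^ 2 else 0))
      ≤ 2 * energyDensity α P w f Q s := by
  have hk := kipriyanovKernel_pos (n := n) (α := α) hs
  have hs0 := hs.1
  have hs1 : 0 < 1 - s := by linarith [hs.2]
  by_cases hQ : Q ∈ Ω
  · have hr : 0 < dist P Q := dist_pos.2 fun h => hP (h ▸ hQ)
    have hg := hw.growth Q hQ s hs
    -- Homotheties send Ω into the ball of radius sR. Recording this as a cutoff is what later
    -- leaves the mass at |P - T| > sR unsubtracted.
    have hle : dist P (dil P s Q) ≤ s * R := by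
      rw [dist_dil P Q hs0.le]
      exact mul_le_mul_of_nonneg_left (hR Q hQ) hs0.le
    rw [if_pos hle, if_pos hle, dist_dil P Q hs0.le, Real.mul_rpow hs0.le hr.le,
      Real.mul_rpow hs0.le hr.le]
    rw [Real.mul_rpow hs1.le hr.le] at hg
    -- The powers of s convert |P - Q| into |P - T|, so that the subtracted terms depend on T alone
    -- and are ready for the change of variables.
    have e1 : s ^ α * s ^ (-α) = 1 := by rw [← Real.rpow_add hs0]; simp
    have e2 : s ^ (α - lam) * s ^ (lam - α) = 1 := by rw [← Real.rpow_add hs0]; simp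
    have e3 : dist P Q ^ (lam - α) = dist P Q ^ lam * dist P Q ^ (-α) := by
      rw [← Real.rpow_add hr, sub_eq_add_neg]
    have h4 := half_normSq_sub_le_inner (f Q) (f (dil P s Q))
    have h5 : w Q * (dist P Q ^ (-α) * (‖f Q‖ ^ 2 - ‖f (dil P s Q)‖ ^ 2)) ≤
        2 * (w Q * (dist P Q ^ (-α) * inner ℝ (f Q) (f Q - f (dil P s Q)))) := by
      have := mul_le_mul_of_nonneg_left h4 (mul_nonneg (hw.nonneg Q)
        (Real.rpow_nonneg hr.le (-α)))
      linarith
    have h6 := mul_le_mul_of_nonneg_right hg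
      (mul_nonneg (Real.rpow_nonneg hr.le (-α)) (sq_nonneg ‖f (dil P s Q)‖))
    unfold energyDensity
    calc _ = kipriyanovKernel n α s * (w Q * (dist P Q ^ (-α) * ‖f Q‖ ^ 2) -
            (s ^ α * s ^ (-α)) * (w (dil P s Q) * (dist P Q ^ (-α) * ‖f (dil P s Q)‖ ^ 2)) -
            (s ^ (α - lam) * s ^ (lam - α)) * (M * (1 - s) ^ lam * (dist P Q ^ (lam - α) *
              ‖f (dil P s Q)‖ ^ 2))) := by ring
      _ ≤ kipriyanovKernel n α s *
          (2 * (w Q * (dist P Q ^ (-α) * inner ℝ (f Q) (f Q - f (dil P s Q))))) := by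
          gcongr
          rw [e1, e2, e3]
          linarith
      _ = _ := by ring
  -- Outside Ω the energy vanishes and the left side is minus nonnegative terms. The inequality thus
  -- holds on the whole space, over which the change of variables is made.
  · have h0 : energyDensity α P w f Q s = 0 := by simp [energyDensity, hw.eq_zero Q hQ]
    rw [h0, hw.eq_zero Q hQ, zero_mul, mul_zero]
    have h1 : 0 ≤ (if dist P (dil P s Q) ≤ s * R then
          w (dil P s Q) * (dist P (dil P s Q) ^ (-α) * ‖f (dil P s Q)‖ ^ 2) else 0) := by
      have := hw.nonneg (dil P s Q)
      split_ifs <;> positivity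
    have h2 : 0 ≤ (if dist P (dil P s Q) ≤ s * R then
          dist P (dil P s Q) ^ (lam - α) * ‖f (dil P s Q)‖ ^ 2 else 0) := by
      split_ifs <;> positivity
    refine mul_nonpos_of_nonneg_of_nonpos hk.le ?_
    have h3 := mul_nonneg (by positivity : 0 ≤ s ^ α) h1
    have h4 := mul_nonneg (by positivity : 0 ≤ M * (1 - s) ^ lam * s ^ (α - lam)) h2
    linarith

end

/-! ### Integration of the lower bound -/

section
variable {n : ℕ} {Ω : Set (EuclideanSpace ℝ (Fin n))} {P : EuclideanSpace ℝ (Fin n)}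
  {R α lam M : ℝ} {w : EuclideanSpace ℝ (Fin n) → ℝ} {f : EuclideanSpace ℝ (Fin n) → ℂ}

/-- Lower bound of the energy at a fixed dilation ratio. -/
theorem slice_energy_ge (hn : 1 ≤ n) (hP : P ∉ Ω) (hR0 : 0 < R) (hR : ∀ Q ∈ Ω, dist P Q ≤ R)
    (hα : 0 < α) (hα1 : α < 1) (hlam : α < lam) (hM : 0 ≤ M)
    (hw : IsRadialWeight Ω P M lam w) (hf : IsTestLimit Ω f) (hf2 : MemLp f 2)
    {s : ℝ} (hs : s ∈ Ioo (0 : ℝ) 1) (hint : Integrable (fun Q => energyDensity α P w f Q s)) :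
    s ^ (α - 1) * (∫ T, if s * R < dist P T then w T * (dist P T ^ (-α) * ‖f T‖ ^ 2) else 0) ≤
      2 * (∫ Q, energyDensity α P w f Q s) +
      M * ((1 - s) ^ (lam - α - 1) * s ^ (-1 - (lam - α)) *
        ∫ T, if dist P T ≤ s * R then dist P T ^ (lam - α) * ‖f T‖ ^ 2 else 0) +
      (s ^ (α - 1) * (1 - s) ^ (-α - 1) - kipriyanovKernel n α s) *
        ∫ T, w T * (dist P T ^ (-α) * ‖f T‖ ^ 2) := by
  have hfm := hf.measurable
  have hs0 := hs.1
  have hs1 : 0 < 1 - s := by linarith [hs.2]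
  have hA : Integrable (fun T => w T * (dist P T ^ (-α) * ‖f T‖ ^ 2)) :=
    hw.integrable_mul (integrable_normSq_mul_dist_rpow hn hP hR0.le hR hα hα1 hf hf2)
  have hF : Integrable (fun T => ‖f T‖ ^ 2) := hf2.integrable_norm_pow two_ne_zero
  have hmle : MeasurableSet {T | dist P T ≤ s * R} := measurableSet_le (by fun_prop) (by fun_prop)
  have hmlt : MeasurableSet {T | s * R < dist P T} := measurableSet_lt (by fun_prop) (by fun_prop)
  have hA1 : Integrable (fun T => if dist P T ≤ s * R then
      w T * (dist P T ^ (-α) * ‖f T‖ ^ 2) else 0) := hA.indicator hmle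
  have hA2 : Integrable (fun T => if s * R < dist P T then
      w T * (dist P T ^ (-α) * ‖f T‖ ^ 2) else 0) := hA.indicator hmlt
  have hsplit : (∫ T, if dist P T ≤ s * R then w T * (dist P T ^ (-α) * ‖f T‖ ^ 2) else 0) =
      (∫ T, w T * (dist P T ^ (-α) * ‖f T‖ ^ 2)) -
        ∫ T, if s * R < dist P T then w T * (dist P T ^ (-α) * ‖f T‖ ^ 2) else 0 := by
    rw [← integral_sub hA hA2]
    refine integral_congr_ae (ae_of_all _ fun T => ?_)
    simp only
    rcases le_or_gt (dist P T) (s * R) with h | h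
    · simp [h, h.not_gt]
    · simp [h, h.not_ge]
  have hE : Integrable (fun T => if dist P T ≤ s * R then
      dist P T ^ (lam - α) * ‖f T‖ ^ 2 else 0) := by
    refine (hF.const_mul ((s * R) ^ (lam - α))).mono'
      (Measurable.ite hmle (by fun_prop) (by fun_prop)).aestronglyMeasurable
      (ae_of_all _ fun T => ?_)
    split_ifs with h
    · rw [Real.norm_of_nonneg (by positivity)]
      have : 0 ≤ lam - α := by linarith
      gcongr
    · rw [norm_zero]; positivity
  set IA := ∫ T, w T * (dist P T ^ (-α) * ‖f T‖ ^ 2) with hIA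
  set IA2 := ∫ T, if s * R < dist P T then w T * (dist P T ^ (-α) * ‖f T‖ ^ 2) else 0 with hIA2
  set IE := ∫ T, if dist P T ≤ s * R then dist P T ^ (lam - α) * ‖f T‖ ^ 2 else 0 with hIE
  have hA1d := integrable_comp_dil P hs0 hA1
  have hEd := integrable_comp_dil P hs0 hE
  have key := integral_mono
    (((hA.sub (hA1d.const_mul (s ^ α))).sub
      (hEd.const_mul (M * (1 - s) ^ lam * s ^ (α - lam)))).const_mul (kipriyanovKernel n α s))
    (hint.const_mul 2) (fun Q => energyDensity_ge (f := f) (α := α) hP hR hM hw Q hs)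
  rw [integral_const_mul, integral_const_mul] at key
  have h2 := integral_sub (hA.sub (hA1d.const_mul (s ^ α)))
    (hEd.const_mul (M * (1 - s) ^ lam * s ^ (α - lam)))
  have h1 := integral_sub hA (hA1d.const_mul (s ^ α))
  simp only [Pi.sub_apply] at h1 h2 key
  rw [h2, h1, integral_const_mul, integral_const_mul,
    integral_comp_dil P hs0 (fun T => if dist P T ≤ s * R then
      w T * (dist P T ^ (-α) * ‖f T‖ ^ 2) else 0),
    integral_comp_dil P hs0 (fun T => if dist P T ≤ s * R then
      dist P T ^ (lam - α) * ‖f T‖ ^ 2 else 0), hsplit] at key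
  obtain ⟨m, rfl⟩ : ∃ m, n = m + 1 := ⟨n - 1, by omega⟩
  have hk : kipriyanovKernel (m + 1) α s = s ^ (m : ℝ) * (1 - s) ^ (-α - 1) := by
    simp [kipriyanovKernel]
  -- The Jacobian s^{-n} meets s^{n-1} from the kernel, so the dimension drops out of the kernels of
  -- both terms in T.
  have e1 : kipriyanovKernel (m + 1) α s * (s ^ α * s ^ (-((m + 1 : ℕ) : ℝ))) =
      s ^ (α - 1) * (1 - s) ^ (-α - 1) := by
    rw [hk, show α - 1 = m + (α + -((m + 1 : ℕ) : ℝ)) by push_cast; ring, Real.rpow_add hs0,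
      Real.rpow_add hs0]
    ring
  have e2 : kipriyanovKernel (m + 1) α s *
      ((1 - s) ^ lam * (s ^ (α - lam) * s ^ (-((m + 1 : ℕ) : ℝ)))) =
      (1 - s) ^ (lam - α - 1) * s ^ (-1 - (lam - α)) := by
    rw [hk, show lam - α - 1 = (-α - 1) + lam by ring,
      show -1 - (lam - α) = m + ((α - lam) + -((m + 1 : ℕ) : ℝ)) by push_cast; ring,
      Real.rpow_add hs0, Real.rpow_add hs0, Real.rpow_add hs1]
    ring
  have hIA20 : 0 ≤ IA2 := integral_nonneg fun T => by
    have := hw.nonneg T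
    simp only [Pi.zero_apply]
    split_ifs <;> positivity
  -- The factor (1-s)^{-α-1} ≥ 1 is given up; the remaining s^{α-1} is the kernel of
  -- `radial_head_eq`.
  have h3 : s ^ (α - 1) * IA2 ≤ s ^ (α - 1) * (1 - s) ^ (-α - 1) * IA2 := by
    have : 1 ≤ (1 - s) ^ (-α - 1) :=
      Real.one_le_rpow_of_pos_of_le_one_of_nonpos hs1 (by linarith) (by linarith)
    gcongr
    exact le_mul_of_one_le_right (by positivity) this
  rw [← e2]
  rw [← e1] at h3 ⊢
  linarith

/-- Integrated lower bound of the energy of the integral part of the Kipriyanov derivative. -/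
theorem energy_ge (hn : 1 ≤ n) (hP : P ∉ Ω) (hR0 : 0 < R) (hR : ∀ Q ∈ Ω, dist P Q ≤ R)
    (hα : 0 < α) (hα1 : α < 1) (hlam : α < lam) (hM : 0 ≤ M)
    (hw : IsRadialWeight Ω P M lam w) (hf : IsTestLimit Ω f) (hf2 : MemLp f 2) :
    Integrable (fun Q => w Q * inner ℝ (f Q) (kipriyanovIntegral α P f Q)) ∧
    R ^ (-α) / α * (∫ Q, w Q * ‖f Q‖ ^ 2) ≤
      2 * (∫ Q, w Q * inner ℝ (f Q) (kipriyanovIntegral α P f Q)) +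
      M * (R ^ (lam - α) / (lam - α) * ∫ Q, ‖f Q‖ ^ 2) +
      Real.Gamma (1 - α) * kipriyanovConst n α / α *
        ∫ Q, w Q * (dist P Q ^ (-α) * ‖f Q‖ ^ 2) := by
  have hfm := hf.measurable
  have hwm := hw.measurable
  have hH := integrable_energyDensity hn hR hα hα1 hw hf hf2
  have hHeq := integral_energyDensity_eq hn hP hR hα hα1 hw hf
  have hA : Integrable (fun T => w T * (dist P T ^ (-α) * ‖f T‖ ^ 2)) :=
    hw.integrable_mul (integrable_normSq_mul_dist_rpow hn hP hR0.le hR hα hα1 hf hf2)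
  have hF : Integrable (fun T => ‖f T‖ ^ 2) := hf2.integrable_norm_pow two_ne_zero
  have hpos : ∀ T ∈ Ω, 0 < dist P T := fun T hT => dist_pos.2 fun h => hP (h ▸ hT)
  have hmem : ∀ T, f T ≠ 0 → T ∈ Ω := fun T hT => by
    by_contra h
    exact hT (hf.eq_zero T h)
  refine ⟨hH.integral_prod_left.congr hHeq, ?_⟩
  obtain ⟨hX, hXle⟩ := radial_tail_le P hR0 (by linarith : 0 < lam - α)
    (F := fun T => ‖f T‖ ^ 2) (by fun_prop) hF (fun T => by positivity) (fun T hT => by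
      have : T ∈ Ω := hmem T (by simpa using hT)
      exact ⟨hpos T this, hR T this⟩)
  obtain ⟨hY, hYeq⟩ := radial_head_eq P hR0 hα
    (A := fun T => w T * (dist P T ^ (-α) * ‖f T‖ ^ 2)) (by fun_prop) hA (fun T hT => by
      refine hR T ?_
      by_contra h
      simp [hw.eq_zero T h] at hT)
  obtain ⟨hK, hKeq⟩ := integral_kernel_difference hn hα hα1
  have hh := hH.integral_prod_right
  have hslice : ∀ᵐ s ∂(volume.restrict (Ioo (0 : ℝ) 1)),
      Integrable (fun Q => energyDensity α P w f Q s) := hH.prod_left_ae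
  have key := integral_mono_ae hY (((hh.const_mul 2).add (hX.const_mul M)).add (hK.mul_const
    (∫ T, w T * (dist P T ^ (-α) * ‖f T‖ ^ 2)))) (by
      filter_upwards [hslice, ae_restrict_mem measurableSet_Ioo] with s hs1 hs2
      exact slice_energy_ge hn hP hR0 hR hα hα1 hlam hM hw hf hf2 hs2 hs1)
  have h1 := integral_add ((hh.const_mul 2).add (hX.const_mul M)) (hK.mul_const
    (∫ T, w T * (dist P T ^ (-α) * ‖f T‖ ^ 2)))
  have h2 := integral_add (hh.const_mul 2) (hX.const_mul M)
  simp only [Pi.add_apply] at h1 h2 key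
  rw [h1, h2, integral_const_mul, integral_const_mul, integral_mul_const, hKeq, hYeq] at key
  have hsw := integral_integral_swap (f := energyDensity α P w f) hH
  simp only [Function.uncurry] at key
  rw [← hsw, integral_congr_ae hHeq] at key
  have hL : ∫ T, (dist P T / R) ^ α / α * (w T * (dist P T ^ (-α) * ‖f T‖ ^ 2)) =
      R ^ (-α) / α * (∫ Q, w Q * ‖f Q‖ ^ 2) := by
    rw [← integral_const_mul]
    refine integral_congr_ae (ae_of_all _ fun T => ?_)
    simp only
    by_cases hT : T ∈ Ω
    · have hr := hpos T hT
      rw [Real.div_rpow hr.le hR0.le, Real.rpow_neg hr.le, Real.rpow_neg hR0.le]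
      field_simp
    · simp [hw.eq_zero T hT]
  rw [hL] at key
  refine key.trans ?_
  gcongr

/-- Lower bound of the quadratic form of the Kipriyanov derivative with a radial weight. -/
theorem quadratic_form_ge (hn : 1 ≤ n) (hP : P ∉ Ω) (hR0 : 0 < R) (hR : ∀ Q ∈ Ω, dist P Q ≤ R)
    (hα : 0 < α) (hα1 : α < 1) (hlam : α < lam) (hM : 0 ≤ M)
    (hw : IsRadialWeight Ω P M lam w) (hf : IsTestLimit Ω f) (hf2 : MemLp f 2) :
    1 / 2 * R ^ (-α) * ((Real.Gamma (1 - α))⁻¹ + kipriyanovConst n α) *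
        (∫ Q, w Q * ‖f Q‖ ^ 2) -
      α * M * R ^ (lam - α) / (2 * Real.Gamma (1 - α) * (lam - α)) * (∫ Q, ‖f Q‖ ^ 2) ≤
    ∫ Q, w Q * inner ℝ (f Q) ((α / Real.Gamma (1 - α)) • kipriyanovIntegral α P f Q +
      (kipriyanovConst n α * dist P Q ^ (-α)) • f Q) := by
  obtain ⟨hJ, hle⟩ := energy_ge hn hP hR0 hR hα hα1 hlam hM hw hf hf2
  have hA : Integrable (fun T => w T * (dist P T ^ (-α) * ‖f T‖ ^ 2)) :=
    hw.integrable_mul (integrable_normSq_mul_dist_rpow hn hP hR0.le hR hα hα1 hf hf2)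
  have hF : Integrable (fun T => ‖f T‖ ^ 2) := hf2.integrable_norm_pow two_ne_zero
  have hΓ : 0 < Real.Gamma (1 - α) := Real.Gamma_pos_of_pos (by linarith)
  have hn1 : (1 : ℝ) ≤ n := by exact_mod_cast hn
  have hC : 0 < kipriyanovConst n α := by
    have := Real.Gamma_pos_of_pos (by linarith : 0 < (n : ℝ) - α)
    unfold kipriyanovConst
    positivity
  have hAF : R ^ (-α) * (∫ Q, w Q * ‖f Q‖ ^ 2) ≤
      ∫ Q, w Q * (dist P Q ^ (-α) * ‖f Q‖ ^ 2) := by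
    rw [← integral_const_mul]
    refine integral_mono ((hw.integrable_mul hF).const_mul _) hA fun Q => ?_
    simp only
    by_cases hQ : Q ∈ Ω
    · have hr : 0 < dist P Q := dist_pos.2 fun h => hP (h ▸ hQ)
      have h1 : R ^ (-α) ≤ dist P Q ^ (-α) :=
        Real.rpow_le_rpow_of_nonpos hr (hR Q hQ) (by linarith)
      have := hw.nonneg Q
      calc R ^ (-α) * (w Q * ‖f Q‖ ^ 2) ≤ dist P Q ^ (-α) * (w Q * ‖f Q‖ ^ 2) := by gcongr
        _ = _ := by ring
    · simp [hw.eq_zero Q hQ]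
  have hsum : ∫ Q, w Q * inner ℝ (f Q) ((α / Real.Gamma (1 - α)) • kipriyanovIntegral α P f Q +
      (kipriyanovConst n α * dist P Q ^ (-α)) • f Q) =
      α / Real.Gamma (1 - α) * (∫ Q, w Q * inner ℝ (f Q) (kipriyanovIntegral α P f Q)) +
      kipriyanovConst n α * ∫ Q, w Q * (dist P Q ^ (-α) * ‖f Q‖ ^ 2) := by
    rw [← integral_const_mul, ← integral_const_mul,
      ← integral_add (hJ.const_mul _) (hA.const_mul _)]
    refine integral_congr_ae (ae_of_all _ fun Q => ?_)
    simp only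
    rw [inner_add_right, inner_smul_right, inner_smul_right, real_inner_self_eq_norm_sq]
    ring
  rw [hsum]
  have hlam' : 0 < lam - α := by linarith
  set IJ := ∫ Q, w Q * inner ℝ (f Q) (kipriyanovIntegral α P f Q)
  set IA := ∫ Q, w Q * (dist P Q ^ (-α) * ‖f Q‖ ^ 2)
  set IG := ∫ Q, w Q * ‖f Q‖ ^ 2
  set IF := ∫ Q, ‖f Q‖ ^ 2
  -- The energy bound carries a factor 2, so it is multiplied by α/(2Γ(1-α)). It then loses exactly
  -- half of the zero-order term; `h2` estimates the other half from below by r ≤ R.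
  have h1 := mul_le_mul_of_nonneg_left hle (by positivity : 0 ≤ α / (2 * Real.Gamma (1 - α)))
  have h2 := mul_le_mul_of_nonneg_left hAF (by positivity : 0 ≤ kipriyanovConst n α / 2)
  have e1 : α / (2 * Real.Gamma (1 - α)) * (R ^ (-α) / α * IG) =
      1 / 2 * R ^ (-α) * (Real.Gamma (1 - α))⁻¹ * IG := by field_simp
  have e2 : α / (2 * Real.Gamma (1 - α)) * (2 * IJ + M * (R ^ (lam - α) / (lam - α) * IF) +
      Real.Gamma (1 - α) * kipriyanovConst n α / α * IA) =
      α / Real.Gamma (1 - α) * IJ +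
      α * M * R ^ (lam - α) / (2 * Real.Gamma (1 - α) * (lam - α)) * IF +
      kipriyanovConst n α / 2 * IA := by field_simp
  rw [e1, e2] at h1
  linarith

end

/-! ### Return to the original derivative, measure and inner product -/

theorem memLp_two_of_lintegral_lt_top {X E : Type*} [MeasurableSpace X] [NormedAddCommGroup E]
    {μ : Measure X} {f : X → E} (hf : AEStronglyMeasurable f μ)
    (h : ∫⁻ x, ‖f x‖ₑ ^ 2 ∂μ < ⊤) : MemLp f 2 μ := by
  rw [lintegral_enorm_sq_eq_eLpNorm] at h
  exact ⟨hf, (ENNReal.pow_lt_top_iff.1 h).resolve_right two_ne_zero⟩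

theorem dil_mem {n : ℕ} {Ω : Set (EuclideanSpace ℝ (Fin n))} (hΩ : IsOpen Ω)
    (hc : Convex ℝ Ω) {P Q : EuclideanSpace ℝ (Fin n)} (hP : P ∈ closure Ω) (hQ : Q ∈ Ω) {s : ℝ}
    (hs : s ∈ Ioo (0 : ℝ) 1) : dil P s Q ∈ Ω := by
  have := hc.add_smul_sub_mem_interior' hP (hΩ.interior_eq.symm ▸ hQ) ⟨hs.1, hs.2.le⟩
  rwa [hΩ.interior_eq] at this

/-- The substitution t = r s. The Jacobian r, applied in `kipriyanovDeriv_eq`, turns r^{-α-1} into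
r^{-α}. -/
theorem kipriyanovIntegrand_mul {n : ℕ} (α : ℝ) {P Q : EuclideanSpace ℝ (Fin n)} (hQ : Q ≠ P)
    (f : EuclideanSpace ℝ (Fin n) → ℂ) {s : ℝ} (hs : s ∈ Ioo (0 : ℝ) 1) :
    kipriyanovIntegrand α P f Q (dist P Q * s) =
      dist P Q ^ (-α - 1) • (kipriyanovKernel n α s • (f Q - f (dil P s Q))) := by
  have hr : 0 < dist P Q := dist_pos.2 (Ne.symm hQ)
  have hs1 : 0 < 1 - s := by linarith [hs.2]
  have h1 : rayPoint P Q (dist P Q * s) = dil P s Q := by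
    rw [rayPoint, dil, smul_smul, mul_right_comm, mul_inv_cancel₀ hr.ne', one_mul]
  have h2 : (dist P Q - dist P Q * s) ^ (α + 1) =
      (dist P Q ^ (-α - 1))⁻¹ * ((1 - s) ^ (-α - 1))⁻¹ := by
    rw [← mul_one_sub, Real.mul_rpow hr.le hs1.le, ← Real.rpow_neg hr.le, ← Real.rpow_neg hs1.le]
    ring_nf
  rw [kipriyanovIntegrand, h1, h2, mul_div_cancel_left₀ _ hr.ne', kipriyanovKernel]
  simp only [Complex.real_smul]
  push_cast
  rw [div_eq_mul_inv, mul_inv, inv_inv, inv_inv]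
  ring

/-- The Kipriyanov derivative of a function which agrees with `f'` at `Q` and almost everywhere
on the segment from `P` to `Q`. -/
theorem kipriyanovDeriv_eq {n : ℕ} {α : ℝ} {P Q : EuclideanSpace ℝ (Fin n)} (hQ : Q ≠ P)
    {f f' : EuclideanSpace ℝ (Fin n) → ℂ} (hf' : Measurable f') (hfin : kipriyanovAbs α P f' Q < ⊤)
    (hfQ : f Q = f' Q)
    (hfs : ∀ᵐ s ∂(volume.restrict (Ioo (0 : ℝ) 1)), f (dil P s Q) = f' (dil P s Q)) :
    IntervalIntegrable (kipriyanovIntegrand α P f Q) volume 0 (dist P Q) ∧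
    kipriyanovDeriv α P f Q = (α / Real.Gamma (1 - α)) • kipriyanovIntegral α P f' Q +
      (kipriyanovConst n α * dist P Q ^ (-α)) • f' Q := by
  have hr : 0 < dist P Q := dist_pos.2 (Ne.symm hQ)
  have hae : (fun s => kipriyanovIntegrand α P f Q (dist P Q * s)) =ᵐ[volume.restrict (Ioo 0 1)]
      fun s => dist P Q ^ (-α - 1) • (kipriyanovKernel n α s • (f' Q - f' (dil P s Q))) := by
    filter_upwards [hfs, ae_restrict_mem measurableSet_Ioo] with s h1 h2
    rw [kipriyanovIntegrand_mul α hQ f h2, hfQ, h1]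
  have hi := (integrableOn_kernel_smul hQ hf' hfin).smul (dist P Q ^ (-α - 1))
  constructor
  · rw [← IntervalIntegrable.comp_mul_left_iff hr.ne' enorm_ne_top enorm_ne_top, zero_div,
      div_self hr.ne', intervalIntegrable_iff_integrableOn_Ioo_of_le zero_le_one]
    exact hi.congr hae.symm
  · have h1 := intervalIntegral.integral_comp_mul_left (a := 0) (b := 1)
      (kipriyanovIntegrand α P f Q) hr.ne'
    rw [mul_zero, mul_one, intervalIntegral.integral_of_le zero_le_one,
      integral_Ioc_eq_integral_Ioo, integral_congr_ae hae, integral_smul,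
      eq_inv_smul_iff₀ hr.ne', smul_smul] at h1
    have h2 : dist P Q * dist P Q ^ (-α - 1) = dist P Q ^ (-α) := by
      rw [Real.rpow_sub_one hr.ne']
      field_simp
    rw [h2] at h1
    rw [kipriyanovDeriv, ← h1, hfQ, kipriyanovIntegral, Complex.real_smul (x := α / _),
      Complex.real_smul (x := kipriyanovConst n α * _)]

section
variable {n : ℕ} {Ω : Set (EuclideanSpace ℝ (Fin n))} {P : EuclideanSpace ℝ (Fin n)}
  {R α lam M : ℝ} {ρ : EuclideanSpace ℝ (Fin n) → ℝ} {f f' : EuclideanSpace ℝ (Fin n) → ℂ}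

theorem ae_kipriyanovDeriv_eq (hn : 1 ≤ n) (hΩ : IsOpen Ω) (hc : Convex ℝ Ω)
    (hP : P ∈ frontier Ω) (hR : ∀ Q ∈ Ω, dist P Q ≤ R) (hα : 0 < α) (hα1 : α < 1)
    (hf' : IsTestLimit Ω f') (h : ∀ᵐ x, x ∈ Ω → f x = f' x) :
    ∀ᵐ Q ∂(volume.restrict Ω),
      IntervalIntegrable (kipriyanovIntegrand α P f Q) volume 0 (dist P Q) ∧
      kipriyanovDeriv α P f Q = (α / Real.Gamma (1 - α)) • kipriyanovIntegral α P f' Q +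
        (kipriyanovConst n α * dist P Q ^ (-α)) • f' Q := by
  have hPΩ : P ∉ Ω := by rw [hΩ.frontier_eq] at hP; exact hP.2
  have hfin := ae_lt_top ((measurable_kipriyanovAbs (α := α) (P := P) hf'.measurable).pow_const 2)
    (hf'.lintegral_kipriyanovAbs_sq_lt_top hn hR hα hα1).ne
  rw [ae_restrict_iff' hΩ.measurableSet]
  filter_upwards [hfin, h, ae_ae_dil P h] with Q h1 h2 h3 hQ
  have hQP : Q ≠ P := fun h => hPΩ (h ▸ hQ)
  refine kipriyanovDeriv_eq hQP hf'.measurable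
    ((ENNReal.pow_lt_top_iff.1 h1).resolve_right two_ne_zero) (h2 hQ) ?_
  filter_upwards [h3, ae_restrict_mem measurableSet_Ioo] with s hs1 hs2
  exact hs1 (dil_mem hΩ hc (frontier_subset_closure hP) hQ hs2)

theorem memLp_kipriyanov (hn : 1 ≤ n) (hP : P ∉ Ω) (hR0 : 0 ≤ R) (hR : ∀ Q ∈ Ω, dist P Q ≤ R)
    (hα : 0 < α) (hα1 : α < 1) (hf : IsTestLimit Ω f) :
    MemLp (fun Q => (α / Real.Gamma (1 - α)) • kipriyanovIntegral α P f Q +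
      (kipriyanovConst n α * dist P Q ^ (-α)) • f Q) 2 := by
  have hfm := hf.measurable
  have h1 : MemLp (kipriyanovIntegral α P f) 2 := by
    refine memLp_two_of_lintegral_lt_top (measurable_kipriyanovIntegral hfm).aestronglyMeasurable ?_
    refine lt_of_le_of_lt (lintegral_mono fun Q => ?_)
      (hf.lintegral_kipriyanovAbs_sq_lt_top hn hR hα hα1)
    exact pow_le_pow_left₀ zero_le (enorm_kipriyanovIntegral_le P f Q) 2
  have h2 : MemLp (fun Q => dist P Q ^ (-α) • f Q) 2 := by
    refine memLp_two_of_lintegral_lt_top (by fun_prop : Measurable _).aestronglyMeasurable ?_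
    refine lt_of_le_of_lt (lintegral_mono fun Q => ?_)
      (hf.lintegral_hardy_lt_top hn hP hR0 hR hα hα1)
    rw [enorm_smul, Real.enorm_of_nonneg (by positivity)]
  have h3 := (h1.const_smul (α / Real.Gamma (1 - α))).add (h2.const_smul (kipriyanovConst n α))
  refine h3.congr_norm ?_ (ae_of_all _ fun Q => ?_)
  · have := measurable_kipriyanovIntegral (α := α) (P := P) hfm
    exact (by fun_prop : Measurable _).aestronglyMeasurable
  · simp [mul_assoc]

/-- Nothing is known about ρ away from the closure of Ω; cutting it off makes the weight globally
measurable, bounded and nonnegative. -/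
theorem weightedMeasure_eq_withDensity_indicator (hΩ : MeasurableSet Ω) :
    weightedMeasure Ω ρ =
      (volume.restrict Ω).withDensity (fun Q => ENNReal.ofReal (Ω.indicator ρ Q)) := by
  refine withDensity_congr_ae ?_
  filter_upwards [ae_restrict_mem hΩ] with Q hQ
  rw [indicator_of_mem hQ]

theorem integral_weightedMeasure {E : Type*} [NormedAddCommGroup E] [NormedSpace ℝ E]
    (hΩ : MeasurableSet Ω) (hw : IsRadialWeight Ω P M lam (Ω.indicator ρ))
    (g : EuclideanSpace ℝ (Fin n) → E) :
    ∫ Q, g Q ∂(weightedMeasure Ω ρ) = ∫ Q, Ω.indicator ρ Q • g Q := by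
  rw [weightedMeasure_eq_withDensity_indicator hΩ,
    integral_withDensity_eq_integral_toReal_smul hw.measurable.ennreal_ofReal
      (ae_of_all _ fun _ => ENNReal.ofReal_lt_top)]
  simp only [ENNReal.toReal_ofReal (hw.nonneg _)]
  exact setIntegral_eq_integral_of_forall_compl_eq_zero fun Q hQ => by
    rw [hw.eq_zero Q hQ, zero_smul]

theorem memLp_weightedMeasure (hΩ : MeasurableSet Ω)
    (hw : IsRadialWeight Ω P M lam (Ω.indicator ρ)) {g : EuclideanSpace ℝ (Fin n) → ℂ}
    (hg : MemLp g 2 (volume.restrict Ω)) : MemLp g 2 (weightedMeasure Ω ρ) := by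
  obtain ⟨B, hB⟩ := hw.bounded
  refine hg.of_measure_le_smul (c := ENNReal.ofReal B) ENNReal.ofReal_ne_top ?_
  rw [weightedMeasure_eq_withDensity_indicator hΩ, ← withDensity_const]
  exact withDensity_mono (ae_of_all _ fun Q => ENNReal.ofReal_le_ofReal (hB Q))

theorem weightedNormSq_eq (hΩ : MeasurableSet Ω)
    (hw : IsRadialWeight Ω P M lam (Ω.indicator ρ)) (h : ∀ᵐ x, x ∈ Ω → f x = f' x) :
    weightedNormSq Ω ρ f = ∫ Q, Ω.indicator ρ Q * ‖f' Q‖ ^ 2 := by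
  rw [weightedNormSq, integral_weightedMeasure hΩ hw]
  refine integral_congr_ae ?_
  filter_upwards [h] with Q hQ
  by_cases hQΩ : Q ∈ Ω
  · rw [hQ hQΩ, smul_eq_mul]
  · simp [hQΩ]

/-- The real inner product on ℂ is Re(f conj g); integrability, from f', g' in L₂ and the bounded
weight, lets the real part pass under the integral. -/
theorem re_weightedInner_eq (hΩ : MeasurableSet Ω)
    (hw : IsRadialWeight Ω P M lam (Ω.indicator ρ)) (h : ∀ᵐ x, x ∈ Ω → f x = f' x)
    {g g' : EuclideanSpace ℝ (Fin n) → ℂ} (hg : ∀ᵐ x, x ∈ Ω → g x = g' x)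
    (hf' : MemLp f' 2) (hg' : MemLp g' 2) :
    (weightedInner Ω ρ f g).re = ∫ Q, Ω.indicator ρ Q * inner ℝ (f' Q) (g' Q) := by
  have hgc : MemLp (fun Q => (starRingEnd ℂ) (g' Q)) 2 := hg'.star
  have hint : Integrable (fun Q => f' Q * (starRingEnd ℂ) (g' Q)) := hf'.integrable_mul hgc
  obtain ⟨B, hB⟩ := hw.bounded
  have hint2 : Integrable (fun Q => Ω.indicator ρ Q • (f' Q * (starRingEnd ℂ) (g' Q))) := by
    refine hint.bdd_smul B hw.measurable.aestronglyMeasurable (ae_of_all _ fun Q => ?_)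
    rw [Real.norm_of_nonneg (hw.nonneg Q)]
    exact hB Q
  have h1 : weightedInner Ω ρ f g = ∫ Q, Ω.indicator ρ Q • (f' Q * (starRingEnd ℂ) (g' Q)) := by
    rw [weightedInner, integral_weightedMeasure hΩ hw]
    refine integral_congr_ae ?_
    filter_upwards [h, hg] with Q hQ hQ'
    by_cases hQΩ : Q ∈ Ω
    · rw [hQ hQΩ, hQ' hQΩ]
    · simp [hQΩ]
  rw [h1, ← Complex.reCLM_apply, ← Complex.reCLM.integral_comp_comm hint2]
  refine integral_congr_ae (ae_of_all _ fun Q => ?_)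
  simp [Complex.inner]
  ring_nf
  simp

theorem isRadialWeight_indicator (hΩ : IsOpen Ω) (hb : Bornology.IsBounded Ω)
    (hρ0 : ∀ Q ∈ Ω, 0 ≤ ρ Q) (hρc : ContinuousOn ρ (closure Ω))
    (hgrow : ∀ Q ∈ Ω, ∀ s ∈ Ioo (0 : ℝ) 1, dil P s Q ∈ Ω ∧
      ρ Q ≤ ρ (dil P s Q) + M * ((1 - s) * dist P Q) ^ lam) :
    IsRadialWeight Ω P M lam (Ω.indicator ρ) := by
  refine ⟨?_, indicator_nonneg hρ0, ?_, fun Q hQ => indicator_of_notMem hQ _, ?_⟩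
  · classical
    rw [← piecewise_eq_indicator]
    exact (hρc.mono subset_closure).measurable_piecewise continuousOn_const hΩ.measurableSet
  · obtain ⟨C, hC⟩ := hb.isCompact_closure.exists_bound_of_continuousOn hρc
    refine ⟨max C 0, fun Q => ?_⟩
    by_cases hQ : Q ∈ Ω
    · rw [indicator_of_mem hQ]
      exact ((le_abs_self _).trans (hC Q (subset_closure hQ))).trans (le_max_left _ _)
    · rw [indicator_of_notMem hQ]
      exact le_max_right _ _
  · intro Q hQ s hs
    obtain ⟨h1, h2⟩ := hgrow Q hQ s hs
    rwa [indicator_of_mem hQ, indicator_of_mem h1]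

end

theorem theorem3p1 {n : ℕ} (hn : 1 ≤ n)
    (Ω : Set (EuclideanSpace ℝ (Fin n)))
    (hΩ_open : IsOpen Ω) (hΩ_convex : Convex ℝ Ω) (hΩ_bdd : Bornology.IsBounded Ω)
    (P : EuclideanSpace ℝ (Fin n)) (hP : P ∈ frontier Ω)
    (α : ℝ) (hα0 : 0 < α) (hα1 : α < 1)
    (ρ : EuclideanSpace ℝ (Fin n) → ℝ) (hρ_nonneg : ∀ Q ∈ Ω, 0 ≤ ρ Q)
    (M lam : NNReal) (hρ_holder : HolderOnWith M lam ρ (closure Ω)) (hlam : α < (lam : ℝ)) :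
    (∀ f : EuclideanSpace ℝ (Fin n) → ℂ, MemH10 Ω f →
      MemLp f 2 (weightedMeasure Ω ρ) ∧
      (∀ᵐ Q ∂(volume.restrict Ω),
        IntervalIntegrable (kipriyanovIntegrand α P f Q) volume 0 (dist P Q)) ∧
      MemLp (kipriyanovDeriv α P f) 2 (weightedMeasure Ω ρ)) ∧
    (0 < sInf (ρ '' Ω) →
      ∀ f : EuclideanSpace ℝ (Fin n) → ℂ, MemH10 Ω f →
        (1 / 2 * Metric.diam Ω ^ (-α) * ((Real.Gamma (1 - α))⁻¹ + kipriyanovConst n α)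
            - α * M * Metric.diam Ω ^ ((lam : ℝ) - α) /
              (2 * Real.Gamma (1 - α) * ((lam : ℝ) - α) * sInf (ρ '' Ω))) * weightedNormSq Ω ρ f
          ≤ (weightedInner Ω ρ f (kipriyanovDeriv α P f)).re) ∧
    (NonincreasingAlongRays Ω P ρ →
      ∀ f : EuclideanSpace ℝ (Fin n) → ℂ, MemH10 Ω f →
        (1 / 2 * Metric.diam Ω ^ (-α) * ((Real.Gamma (1 - α))⁻¹ + kipriyanovConst n α))
            * weightedNormSq Ω ρ f
          ≤ (weightedInner Ω ρ f (kipriyanovDeriv α P f)).re) := by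
  have hPc : P ∈ closure Ω := frontier_subset_closure hP
  have hPΩ : P ∉ Ω := by rw [hΩ_open.frontier_eq] at hP; exact hP.2
  have hR : ∀ Q ∈ Ω, dist P Q ≤ Metric.diam Ω := fun Q hQ => by
    rw [← Metric.diam_closure]
    exact Metric.dist_le_diam_of_mem hΩ_bdd.closure hPc (subset_closure hQ)
  have hR0 : 0 < Metric.diam Ω := by
    obtain ⟨Q, hQ⟩ := closure_nonempty_iff.1 ⟨P, hPc⟩
    have hPQ : P ≠ Q := fun h => hPΩ (h ▸ hQ)
    exact (dist_pos.2 hPQ).trans_le (hR Q hQ)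
  have hlam0 : (0 : ℝ) < lam := hα0.trans hlam
  have hlamα : 0 < (lam : ℝ) - α := sub_pos.2 hlam
  have hΓ : 0 < Real.Gamma (1 - α) := Real.Gamma_pos_of_pos (by linarith)
  have hdil : ∀ Q ∈ Ω, ∀ s ∈ Ioo (0 : ℝ) 1, dil P s Q ∈ Ω := fun Q hQ s hs =>
    dil_mem hΩ_open hΩ_convex hPc hQ hs
  have hρc : ContinuousOn ρ (closure Ω) := hρ_holder.continuousOn (by exact_mod_cast hlam0)
  have hw : IsRadialWeight Ω P M lam (Ω.indicator ρ) := by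
    refine isRadialWeight_indicator hΩ_open hΩ_bdd hρ_nonneg hρc fun Q hQ s hs =>
      ⟨hdil Q hQ s hs, ?_⟩
    have h1 := hρ_holder.dist_le (subset_closure hQ) (subset_closure (hdil Q hQ s hs))
    have h2 : dist Q (dil P s Q) = (1 - s) * dist P Q := by
      rw [dil, dist_eq_norm, show Q - (P + s • (Q - P)) = (1 - s) • (Q - P) by module, norm_smul,
        Real.norm_of_nonneg (by linarith [hs.2]), dist_comm, dist_eq_norm]
    rw [h2, Real.dist_eq] at h1
    linarith [le_abs_self (ρ Q - ρ (dil P s Q))]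
  refine ⟨fun f hf => ?_, fun hinf f hf => ?_, fun hmono f hf => ?_⟩
  · obtain ⟨f', hf', hf2, hff'⟩ := hf.exists_isTestLimit hΩ_open
    have hD := ae_kipriyanovDeriv_eq hn hΩ_open hΩ_convex hP hR hα0 hα1 hf' hff'
    refine ⟨memLp_weightedMeasure hΩ_open.measurableSet hw hf.1, hD.mono fun Q hQ => hQ.1,
      memLp_weightedMeasure hΩ_open.measurableSet hw ?_⟩
    exact (memLp_kipriyanov hn hPΩ hR0.le hR hα0 hα1 hf').restrict Ω |>.ae_eq
      (hD.mono fun Q hQ => hQ.2.symm)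
  · obtain ⟨f', hf', hf2, hff'⟩ := hf.exists_isTestLimit hΩ_open
    have hD := ae_kipriyanovDeriv_eq hn hΩ_open hΩ_convex hP hR hα0 hα1 hf' hff'
    rw [weightedNormSq_eq hΩ_open.measurableSet hw hff',
      re_weightedInner_eq hΩ_open.measurableSet hw hff'
        ((ae_restrict_iff' hΩ_open.measurableSet).1 (hD.mono fun Q hQ => hQ.2)) hf2
        (memLp_kipriyanov hn hPΩ hR0.le hR hα0 hα1 hf')]
    refine le_trans ?_ (quadratic_form_ge hn hPΩ hR0 hR hα0 hα1 hlam M.coe_nonneg hw hf' hf2)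
    have hF : Integrable (fun T => ‖f' T‖ ^ 2) := hf2.integrable_norm_pow two_ne_zero
    -- The growth error is measured by the unweighted norm; this comparison absorbs it into the
    -- weighted one and produces inf ρ in the denominator.
    have hle : sInf (ρ '' Ω) * (∫ Q, ‖f' Q‖ ^ 2) ≤ ∫ Q, Ω.indicator ρ Q * ‖f' Q‖ ^ 2 := by
      rw [← integral_const_mul]
      refine integral_mono (hF.const_mul _) (hw.integrable_mul hF) fun Q => ?_
      by_cases hQ : Q ∈ Ω
      · simp only [indicator_of_mem hQ]
        gcongr
        exact csInf_le ⟨0, forall_mem_image.2 hρ_nonneg⟩ (mem_image_of_mem ρ hQ)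
      · simp [hf'.eq_zero Q hQ]
    rw [sub_mul]
    gcongr ?_ - ?_
    have hc : 0 ≤ α * M * Metric.diam Ω ^ ((lam : ℝ) - α) /
        (2 * Real.Gamma (1 - α) * ((lam : ℝ) - α) * sInf (ρ '' Ω)) := by positivity
    refine le_trans (le_of_eq ?_) (mul_le_mul_of_nonneg_left hle hc)
    field_simp
  · obtain ⟨f', hf', hf2, hff'⟩ := hf.exists_isTestLimit hΩ_open
    have hD := ae_kipriyanovDeriv_eq hn hΩ_open hΩ_convex hP hR hα0 hα1 hf' hff'
    -- Monotonicity along the ray, compared at the parameters s r ≤ r, gives ρ(Q) ≤ ρ(T), which is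
    -- the growth condition with M = 0.
    have hw0 : IsRadialWeight Ω P 0 lam (Ω.indicator ρ) := by
      refine isRadialWeight_indicator hΩ_open hΩ_bdd hρ_nonneg hρc fun Q hQ s hs =>
        ⟨hdil Q hQ s hs, ?_⟩
      have hr : 0 < dist P Q := dist_pos.2 fun h => hPΩ (h ▸ hQ)
      have hd : ∀ t : ℝ, P + (t * dist P Q) • ((dist P Q)⁻¹ • (Q - P)) = dil P t Q := by
        intro t
        rw [dil, smul_smul, mul_assoc, mul_inv_cancel₀ hr.ne', mul_one]
      have he : ‖(dist P Q)⁻¹ • (Q - P)‖ = 1 := by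
        rw [norm_smul, norm_inv, Real.norm_of_nonneg hr.le, dist_comm, dist_eq_norm,
          inv_mul_cancel₀]
        rw [← dist_eq_norm, dist_comm]
        exact hr.ne'
      have h := hmono _ he (a := s * dist P Q) (b := 1 * dist P Q)
        ⟨mul_pos hs.1 hr, by rw [hd]; exact hdil Q hQ s hs⟩
        ⟨by rwa [one_mul], by rw [hd, dil_one]; exact hQ⟩ (by gcongr; exact hs.2.le)
      simp only [hd, dil_one] at h
      simpa using h
    rw [weightedNormSq_eq hΩ_open.measurableSet hw hff',
      re_weightedInner_eq hΩ_open.measurableSet hw hff'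
        ((ae_restrict_iff' hΩ_open.measurableSet).1 (hD.mono fun Q hQ => hQ.2)) hf2
        (memLp_kipriyanov hn hPΩ hR0.le hR hα0 hα1 hf')]
    have h := quadratic_form_ge hn hPΩ hR0 hR hα0 hα1 hlam le_rfl hw0 hf' hf2
    simpa using h
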